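/- Notation. For a vector field $u$ on $\mathbb{R}^3$ let $Du=\frac12(\nabla u+(\nabla u)^t)$. Let $\mathcal{U}(x)=\frac1{8\pi}\left(\frac{I}{|x|}+\frac{x\otimes x}{|x|^3}\right)$ be the Oseen tensor. For a symmetric trace-free matrix $S$ let $V[S](x)=Sx$ if $|x|\le 1$, and $$V[S](x)=\tfrac52\,\big(S:(x\otimes x)\big)\frac{x}{|x|^5}+\frac{Sx}{|x|^5}-\tfrac52\,\big(S:(x\otimes x)\big)\frac{x}{|x|^7}\quad\text{if } |x|>1 .$$ Let $1\le p<\infty$, $p'=\frac p{p-1}$ ($p'=\infty$ if $p=1$), let $f\in L^1(\mathbb{R}^3)\cap L^\infty(\mathbb{R}^3)$ be a vector field and let $K>0$. Then there is a constant $C>0$, depending only on $p$, $f$ and $K$, such that the following holds. Let $\lambda>0$ and, for $n\ge1$, let $r_n$ be given by $\lambda=\frac{4\pi}3 n r_n^3$. For each $n$ let $x_1,\dots,x_n\in\mathbb{R}^3$ (depending on $n$) be such that (A0) $\frac1n\sum_{i}\delta_{x_i}\to\rho(x)\,dx$ weakly in the sense of measures as $n\to\infty$, where $\rho\in L^\infty(\mathbb{R}^3)$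 vanishes outside a bounded open set $\mathcal{O}$; (B1) there is $M>2$ such that $|x_i-x_j|\ge M r_n$ for all $n$ and all $1\le i\ne j\le n$; (B2) $\#\{i:\ \exists j\ne i,\ |x_i-x_j|\le\eta' n^{-1/3}\}\le K\eta'^3 n$ for all $\eta'>0$ and all $n$. Let $f_n\in L^{6/5}(\mathbb{R}^3)$ be vector fields with $f_n\to f$ in $L^{6/5}(\mathbb{R}^3)$, let $\varphi$ be a smooth, compactly supported, divergence-free vector field on $\mathbb{R}^3$, let $\eta>0$, let $\mathcal{G}_\eta=\{1\le i\le n:\ \forall j\ne i,\ |x_i-x_j|\ge\eta n^{-1/3}\}$, and put $$\phi_{app,n}(x)=\big(\mathcal{U}\star\operatorname{div}(5\lambda\rho D\varphi)\big)(x)+\sum_{i\in\mathcal{G}_\eta} r_n\,V[D\varphi(x_i)]\Big(\frac{x-x_i}{r_n}\Big),$$ where the divergence is taken in the sense of distributions, i.e. the $i$-th component of the first term is $\sum_{j,k}(\partial_k\mathcal{U}_{ij})\star(5\lambda\rho (D\varphi)_{jk})$. Then $f_n\cdot\phi_{app,n}$ is integrable for every $n$, and $$\limsup_{n\to\infty}\Big|\int_{\mathbb{R}^3}f_n\cdot\phi_{app,n}\Big|\le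 C\,(\lambda\eta^3)^{\frac1p}\,\|\nabla\varphi\|_{L^{p'}(\mathbb{R}^3)} .$$ -/

import Mathlib

open MeasureTheory Filter Topology
open scoped ENNReal ContDiff

noncomputable section

/-- Three-dimensional Euclidean space. -/
abbrev E3 : Type := EuclideanSpace ℝ (Fin 3)

/-- The partial derivative `∂ₖ uᵢ` of a vector field, at the point `x`. -/
def partialDeriv (u : E3 → E3) (k i : Fin 3) (x : E3) : ℝ :=
  (fderiv ℝ u x (EuclideanSpace.single k 1)) i

/-- The divergence of a vector field. -/
def divergence (u : E3 → E3) (x : E3) : ℝ := ∑ i, partialDeriv u i i x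

/-- The symmetric gradient `D u = (∇u + (∇u)ᵗ) / 2`. -/
def symGrad (u : E3 → E3) (x : E3) : Matrix (Fin 3) (Fin 3) ℝ :=
  Matrix.of fun i j => (partialDeriv u j i x + partialDeriv u i j x) / 2

/-- The vector `S x`, for a matrix `S`. -/
def matVec (S : Matrix (Fin 3) (Fin 3) ℝ) (x : E3) : E3 :=
  WithLp.toLp 2 fun i => ∑ j, S i j * x j

/-- The quadratic form `S : (x ⊗ x)`. -/
def quadForm (S : Matrix (Fin 3) (Fin 3) ℝ) (x : E3) : ℝ :=
  ∑ i, ∑ j, S i j * x i * x j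

/-- The Oseen tensor `U(x) = (1 / 8π) (I / |x| + x ⊗ x / |x|³)`, the fundamental solution of
`-Δu + ∇p = g`, `div u = 0` in the whole space. -/
def oseen (x : E3) : Matrix (Fin 3) (Fin 3) ℝ :=
  Matrix.of fun i j =>
    1 / (8 * Real.pi) * ((if i = j then 1 else 0) / ‖x‖ + x i * x j / ‖x‖ ^ 3)

/-- The partial derivative `∂ₖ Uᵢⱼ` of the Oseen tensor. -/
def oseenDeriv (i j k : Fin 3) (x : E3) : ℝ :=
  fderiv ℝ (fun z => oseen z i j) x (EuclideanSpace.single k 1)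

/-- The free-space solution `U ⋆ div T` of `-Δu + ∇p = div T`, `div u = 0`, for a bounded,
compactly supported matrix field `T`. As `T` need not be differentiable, the divergence is taken in
the sense of distributions and the derivative falls on the (locally integrable) kernel:
`(U ⋆ div T)ᵢ = ∑ⱼₖ (∂ₖ Uᵢⱼ) ⋆ Tⱼₖ`. -/
def oseenConvDiv (T : E3 → Matrix (Fin 3) (Fin 3) ℝ) (x : E3) : E3 :=
  WithLp.toLp 2 fun i => ∫ y, ∑ j, ∑ k, oseenDeriv i j k (x - y) * T y j k

/-- The whole-space part `U ⋆ div (5 λ ρ D φ)` of the approximation. -/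
def phiFree (lam : ℝ) (ρ : E3 → ℝ) (φ : E3 → E3) : E3 → E3 :=
  oseenConvDiv fun y => (5 * lam * ρ y) • symGrad φ y

/-- The field `V[S]`: equal to `S x` in the unit ball and to the decaying Stokes flow with these
boundary values outside it. -/
def ballFlow (S : Matrix (Fin 3) (Fin 3) ℝ) (x : E3) : E3 :=
  open Classical in
  if ‖x‖ ≤ 1 then matVec S x
  else (5 / 2 * quadForm S x / ‖x‖ ^ 5) • x + (1 / ‖x‖ ^ 5) • matVec S x
    - (5 / 2 * quadForm S x / ‖x‖ ^ 7) • x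

/-- The single-ball correction `r V[D φ(a)]((x - a) / r)` for the ball of centre `a` and
radius `r`. -/
def phiBall (φ : E3 → E3) (r : ℝ) (a x : E3) : E3 :=
  r • ballFlow (symGrad φ a) (r⁻¹ • (x - a))

/-- The good indices: the centres at distance at least `η n^(-1/3)` from all the others. -/
def goodSet {n : ℕ} (X : Fin n → E3) (η : ℝ) : Finset (Fin n) :=
  open Classical in
  Finset.univ.filter fun i => ∀ j, j ≠ i → η * (n : ℝ) ^ (-(1 / 3 : ℝ)) ≤ ‖X i - X j‖

/-- The approximation `φ_app = U ⋆ div (5 λ ρ D φ) + ∑ over good balls of single-ball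
corrections`. -/
def phiApp (lam : ℝ) (ρ : E3 → ℝ) (φ : E3 → E3) (η r : ℝ) {n : ℕ} (X : Fin n → E3) (x : E3) :
    E3 :=
  phiFree lam ρ φ x + ∑ i ∈ goodSet X η, phiBall φ r (X i) x

/-- The empirical measures `(1 / n) ∑ δ_{xᵢ}` converge weakly to `ρ dx`. -/
def EmpiricalLimit (X : (n : ℕ) → Fin n → E3) (ρ : E3 → ℝ) : Prop :=
  ∀ g : BoundedContinuousFunction E3 ℝ,
    Tendsto (fun n : ℕ => (1 / (n : ℝ)) * ∑ i, g (X n i)) atTop (𝓝 (∫ x, g x * ρ x))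

/-- Uniform separation: for some `M > 2`, distinct centres are at distance at least `M rₙ`. -/
def Separated (X : (n : ℕ) → Fin n → E3) (r : ℕ → ℝ) : Prop :=
  ∃ M : ℝ, 2 < M ∧ ∀ n : ℕ, ∀ i j : Fin n, i ≠ j → M * r n ≤ ‖X n i - X n j‖

/-- Few close pairs, with constant `K`: for all `η > 0` and `n`, at most `K η³ n` centres have
another centre within distance `η n^(-1/3)`. -/
def FewClose (X : (n : ℕ) → Fin n → E3) (K : ℝ) : Prop :=
  ∀ η : ℝ, 0 < η → ∀ n : ℕ,
    (Set.ncard {i : Fin n | ∃ j, j ≠ i ∧ ‖X n i - X n j‖ ≤ η * (n : ℝ) ^ (-(1 / 3 : ℝ))} : ℝ)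
      ≤ K * η ^ 3 * n

end

/-! Write `stresslet S z` for (S : z ⊗ z) z / |z|⁵. Since `symGrad φ` is symmetric and trace-free,
the whole-space part is a superposition of stresslets of density -15λρ/(8π) (`phiFree_eq`). A
single-ball correction has far field (5/2) r³ times a stresslet, and 4πnr³/3 = λ turns (5/2) r³ into
15λ/(8πn). With the good balls replaced by all balls, the two parts therefore cancel to leading
order.

To test against a fixed f in L¹ ∩ L^∞, put g(y) = ∫ f(x) · stresslet(Dφ(y))(x - y) dx
(`stressletPairing`). The |z|⁻² singularity is integrable, so g is bounded and continuous, with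
|g(y)| ≤ C|∇φ(y)|. Up to near-field errors of total size O(r), the integral of f · φ_app is 15λ/(8π)
times ((1/n) ∑ g(xᵢ) - ∫ gρ), minus 15λ/(8πn) times the sum of g over the bad indices
(`abs_integral_inner_phiApp_le`). The first term vanishes in the limit by weak convergence.

At most Kη³n indices are bad, so Hölder bounds their contribution by (λKη³)^(1/p) times the discrete
p'-norm of ∇φ with weights λ/n. Those weights are the volumes of disjoint balls, so the discrete
norm is asymptotically at most the L^{p'} norm (`eventually_sum_badSet_le`).

Finally f_n may be replaced by f: all the φ_app are dominated by one multiple of (1 + |x|)⁻²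
(`exists_norm_phiApp_le`), hence bounded in L⁶, the dual of L^{6/5}. -/

noncomputable section

/-! ### Pointwise bounds for the single-ball flow and its far field -/

/-- The far-field kernel `(S : z ⊗ z) z / |z|⁵`. -/
def stresslet (S : Matrix (Fin 3) (Fin 3) ℝ) (z : E3) : E3 := (quadForm S z / ‖z‖ ^ 5) • z

lemma abs_coord_le_norm (x : E3) (i : Fin 3) : |x i| ≤ ‖x‖ := by
  simpa using PiLp.norm_apply_le x i

lemma norm_le_sum_abs_coord (x : E3) : ‖x‖ ≤ ∑ i, |x i| := by
  rw [EuclideanSpace.norm_eq]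
  refine Real.sqrt_le_iff.2 ⟨by positivity, ?_⟩
  simp only [Fin.sum_univ_three, Real.norm_eq_abs]
  nlinarith [abs_nonneg (x 0), abs_nonneg (x 1), abs_nonneg (x 2),
    mul_nonneg (abs_nonneg (x 0)) (abs_nonneg (x 1)),
    mul_nonneg (abs_nonneg (x 0)) (abs_nonneg (x 2)),
    mul_nonneg (abs_nonneg (x 1)) (abs_nonneg (x 2))]

/-- Matrices are measured by their largest entry; the factor 9 counts entries and is not optimal. -/
lemma abs_quadForm_le {S : Matrix (Fin 3) (Fin 3) ℝ} {s : ℝ} (hS : ∀ i j, |S i j| ≤ s)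
    (x : E3) : |quadForm S x| ≤ 9 * s * ‖x‖ ^ 2 := by
  have hs : 0 ≤ s := (abs_nonneg _).trans (hS 0 0)
  calc |quadForm S x| ≤ ∑ i, ∑ j, |S i j * x i * x j| :=
        (Finset.abs_sum_le_sum_abs _ _).trans
          (Finset.sum_le_sum fun i _ => Finset.abs_sum_le_sum_abs _ _)
    _ ≤ ∑ _i : Fin 3, ∑ _j : Fin 3, s * ‖x‖ * ‖x‖ := by
        refine Finset.sum_le_sum fun i _ => Finset.sum_le_sum fun j _ => ?_
        rw [abs_mul, abs_mul]
        gcongr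
        exacts [hS i j, abs_coord_le_norm x i, abs_coord_le_norm x j]
    _ = 9 * s * ‖x‖ ^ 2 := by simp; ring

lemma norm_matVec_le {S : Matrix (Fin 3) (Fin 3) ℝ} {s : ℝ} (hS : ∀ i j, |S i j| ≤ s)
    (x : E3) : ‖matVec S x‖ ≤ 9 * s * ‖x‖ := by
  have hs : 0 ≤ s := (abs_nonneg _).trans (hS 0 0)
  calc ‖matVec S x‖ ≤ ∑ i, |∑ j, S i j * x j| := norm_le_sum_abs_coord _
    _ ≤ ∑ i, ∑ j, |S i j * x j| :=
        Finset.sum_le_sum fun i _ => Finset.abs_sum_le_sum_abs _ _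
    _ ≤ ∑ _i : Fin 3, ∑ _j : Fin 3, s * ‖x‖ := by
        refine Finset.sum_le_sum fun i _ => Finset.sum_le_sum fun j _ => ?_
        rw [abs_mul]
        gcongr
        exacts [hS i j, abs_coord_le_norm x j]
    _ = 9 * s * ‖x‖ := by simp; ring

/-- Used with m = 2 for the far field and with m = 4 for the faster decaying term of `ballFlow`. -/
lemma norm_quadForm_div_smul_le {S : Matrix (Fin 3) (Fin 3) ℝ} {s : ℝ}
    (hS : ∀ i j, |S i j| ≤ s) (x : E3) (m : ℕ) :
    ‖(quadForm S x / ‖x‖ ^ (m + 3)) • x‖ ≤ 9 * s * (‖x‖ ^ m)⁻¹ := by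
  have hs : 0 ≤ s := (abs_nonneg _).trans (hS 0 0)
  rcases eq_or_ne x 0 with rfl | hx
  · simp only [smul_zero, norm_zero]; positivity
  have hx' : 0 < ‖x‖ := norm_pos_iff.2 hx
  rw [norm_smul, norm_div, Real.norm_eq_abs, norm_pow, norm_norm]
  calc |quadForm S x| / ‖x‖ ^ (m + 3) * ‖x‖ ≤ 9 * s * ‖x‖ ^ 2 / ‖x‖ ^ (m + 3) * ‖x‖ := by
        gcongr; exact abs_quadForm_le hS x
    _ = 9 * s * (‖x‖ ^ m)⁻¹ := by field_simp; ring

lemma norm_stresslet_le {S : Matrix (Fin 3) (Fin 3) ℝ} {s : ℝ} (hS : ∀ i j, |S i j| ≤ s)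
    (z : E3) : ‖stresslet S z‖ ≤ 9 * s * (‖z‖ ^ 2)⁻¹ :=
  norm_quadForm_div_smul_le hS z 2

lemma quadForm_smul (S : Matrix (Fin 3) (Fin 3) ℝ) (t : ℝ) (z : E3) :
    quadForm S (t • z) = t ^ 2 * quadForm S z := by
  simp only [quadForm, Finset.mul_sum, PiLp.smul_apply, smul_eq_mul]
  exact Finset.sum_congr rfl fun i _ => Finset.sum_congr rfl fun j _ => by ring

/-- Homogeneity of degree -2: with the prefactor r of `phiBall`, it gives the far field strength r³.
-/
lemma stresslet_smul (S : Matrix (Fin 3) (Fin 3) ℝ) {t : ℝ} (ht : 0 < t) (z : E3) :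
    stresslet S (t • z) = (t ^ 2)⁻¹ • stresslet S z := by
  rcases eq_or_ne z 0 with rfl | hz
  · simp [stresslet]
  have hz' : ‖z‖ ≠ 0 := norm_ne_zero_iff.2 hz
  simp only [stresslet, quadForm_smul, norm_smul, smul_smul, Real.norm_eq_abs, abs_of_pos ht]
  congr 1
  field_simp

lemma norm_ballFlow_le {S : Matrix (Fin 3) (Fin 3) ℝ} {s : ℝ} (hS : ∀ i j, |S i j| ≤ s)
    (x : E3) : ‖ballFlow S x‖ ≤ 54 * s * (max ‖x‖ 1 ^ 2)⁻¹ := by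
  have hs : 0 ≤ s := (abs_nonneg _).trans (hS 0 0)
  unfold ballFlow
  split_ifs with h
  · rw [max_eq_right h]
    have := norm_matVec_le hS x
    nlinarith
  · push Not at h
    rw [max_eq_left h.le]
    have hx : 0 < ‖x‖ := by linarith
    have h1 := norm_quadForm_div_smul_le hS x 2
    have h2 := norm_quadForm_div_smul_le hS x 4
    have h3 := norm_matVec_le hS x
    have h42 : (‖x‖ ^ 4)⁻¹ ≤ (‖x‖ ^ 2)⁻¹ := by
      gcongr <;> first | exact h.le | norm_num
    rw [mul_div_assoc, mul_div_assoc, mul_smul, mul_smul]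
    refine (norm_sub_le _ _).trans ((add_le_add_left (norm_add_le _ _) _).trans ?_)
    rw [norm_smul (5 / 2 : ℝ), norm_smul (5 / 2 : ℝ), norm_smul (1 / ‖x‖ ^ 5)]
    have e1 : ‖(5 / 2 : ℝ)‖ = 5 / 2 := by norm_num
    have e2 : ‖1 / ‖x‖ ^ 5‖ = 1 / ‖x‖ ^ 5 := by
      rw [Real.norm_eq_abs, abs_of_pos (by positivity)]
    rw [e1, e2]
    have h4 : 1 / ‖x‖ ^ 5 * ‖matVec S x‖ ≤ 9 * s * (‖x‖ ^ 4)⁻¹ := by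
      calc _ ≤ 1 / ‖x‖ ^ 5 * (9 * s * ‖x‖) := by gcongr
        _ = _ := by field_simp
    have h5 : 9 * s * (‖x‖ ^ 4)⁻¹ ≤ 9 * s * (‖x‖ ^ 2)⁻¹ := by gcongr
    norm_num at h1 h2
    linarith

/-- The radial majorant of the difference between `ballFlow` and its far field. -/
def coreWeight (t : ℝ) : ℝ := if t ≤ 1 then (t ^ 2)⁻¹ else (t ^ 4)⁻¹

lemma coreWeight_nonneg (t : ℝ) : 0 ≤ coreWeight t := by
  unfold coreWeight; split_ifs <;> positivity

/-- Outside the unit ball the |x|⁻² terms cancel exactly, leaving |x|⁻⁴; inside, the crude |x|⁻²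
bound suffices. The majorant is thus integrable both at 0 and at infinity in dimension three. -/
lemma norm_ballFlow_sub_stresslet_le {S : Matrix (Fin 3) (Fin 3) ℝ} {s : ℝ}
    (hS : ∀ i j, |S i j| ≤ s) (x : E3) :
    ‖ballFlow S x - (5 / 2 : ℝ) • stresslet S x‖ ≤ 36 * s * coreWeight ‖x‖ := by
  have hs : 0 ≤ s := (abs_nonneg _).trans (hS 0 0)
  -- At the origin every term is 0, since 0⁻¹ = 0.
  rcases eq_or_ne x 0 with rfl | hx
  · have : matVec S 0 = 0 := by ext i; simp [matVec]
    simp [ballFlow, stresslet, coreWeight, this]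
  have hx : 0 < ‖x‖ := norm_pos_iff.2 hx
  have h3 := norm_matVec_le hS x
  have e1 : ‖(5 / 2 : ℝ)‖ = 5 / 2 := by norm_num
  unfold ballFlow coreWeight
  split_ifs with h
  · refine (norm_sub_le _ _).trans ?_
    rw [norm_smul (5 / 2 : ℝ), e1]
    have h1 := norm_stresslet_le hS x
    have h2 : ‖x‖ ≤ (‖x‖ ^ 2)⁻¹ := h.trans (one_le_inv₀ (by positivity) |>.2 (by nlinarith))
    have h4 : 9 * s * ‖x‖ ≤ 9 * s * (‖x‖ ^ 2)⁻¹ := by gcongr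
    have h5 : 0 ≤ s * (‖x‖ ^ 2)⁻¹ := by positivity
    linarith
  · push Not at h
    have h2 := norm_quadForm_div_smul_le hS x 4
    have e2 : ‖1 / ‖x‖ ^ 5‖ = 1 / ‖x‖ ^ 5 := by
      rw [Real.norm_eq_abs, abs_of_pos (by positivity)]
    have h4 : 1 / ‖x‖ ^ 5 * ‖matVec S x‖ ≤ 9 * s * (‖x‖ ^ 4)⁻¹ := by
      calc _ ≤ 1 / ‖x‖ ^ 5 * (9 * s * ‖x‖) := by gcongr
        _ = _ := by field_simp
    have h5 : 0 ≤ s * (‖x‖ ^ 4)⁻¹ := by positivity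
    rw [mul_div_assoc, mul_div_assoc, mul_smul, mul_smul]
    have : (5 / 2 : ℝ) • (quadForm S x / ‖x‖ ^ 5) • x + (1 / ‖x‖ ^ 5) • matVec S x -
        (5 / 2 : ℝ) • (quadForm S x / ‖x‖ ^ 7) • x - (5 / 2 : ℝ) • stresslet S x =
        (1 / ‖x‖ ^ 5) • matVec S x - (5 / 2 : ℝ) • (quadForm S x / ‖x‖ ^ 7) • x := by
      unfold stresslet; abel
    rw [this]
    refine (norm_sub_le _ _).trans ?_
    rw [norm_smul (5 / 2 : ℝ), norm_smul (1 / ‖x‖ ^ 5), e1, e2]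
    norm_num at h2
    linarith

lemma abs_symGrad_le (φ : E3 → E3) (y : E3) (i j : Fin 3) :
    |symGrad φ y i j| ≤ ‖fderiv ℝ φ y‖ := by
  have h : ∀ k l, |partialDeriv φ k l y| ≤ ‖fderiv ℝ φ y‖ := fun k l => by
    refine (abs_coord_le_norm _ l).trans (((fderiv ℝ φ y).le_opNorm _).trans ?_)
    simp
  simp only [symGrad, Matrix.of_apply, abs_div, abs_two]
  have := abs_add_le (partialDeriv φ j i y) (partialDeriv φ i j y)
  have := h i j
  have := h j i
  linarith

lemma norm_phiBall_le (φ : E3 → E3) {r : ℝ} (hr : 0 < r) (a x : E3) :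
    ‖phiBall φ r a x‖ ≤ 54 * ‖fderiv ℝ φ a‖ * (r ^ 3 * (max ‖x - a‖ r ^ 2)⁻¹) := by
  have h := norm_ballFlow_le (abs_symGrad_le φ a) (r⁻¹ • (x - a))
  have e : max ‖r⁻¹ • (x - a)‖ 1 = r⁻¹ * max ‖x - a‖ r := by
    rw [norm_smul, norm_inv, Real.norm_eq_abs, abs_of_pos hr, mul_max_of_nonneg _ _ (by positivity),
      inv_mul_cancel₀ hr.ne']
  rw [phiBall, norm_smul, Real.norm_eq_abs, abs_of_pos hr]
  calc _ ≤ r * (54 * ‖fderiv ℝ φ a‖ * (max ‖r⁻¹ • (x - a)‖ 1 ^ 2)⁻¹) := by gcongr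
    _ = _ := by rw [e]; have : 0 < max ‖x - a‖ r := lt_max_of_lt_right hr; field_simp

lemma norm_phiBall_sub_stresslet_le (φ : E3 → E3) {r : ℝ} (hr : 0 < r) (a x : E3) :
    ‖phiBall φ r a x - (5 / 2 * r ^ 3) • stresslet (symGrad φ a) (x - a)‖ ≤
      36 * ‖fderiv ℝ φ a‖ * (r * coreWeight ‖r⁻¹ • (x - a)‖) := by
  have h := norm_ballFlow_sub_stresslet_le (abs_symGrad_le φ a) (r⁻¹ • (x - a))
  have e : phiBall φ r a x - (5 / 2 * r ^ 3) • stresslet (symGrad φ a) (x - a) =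
      r • (ballFlow (symGrad φ a) (r⁻¹ • (x - a)) -
        (5 / 2 : ℝ) • stresslet (symGrad φ a) (r⁻¹ • (x - a))) := by
    rw [stresslet_smul _ (inv_pos.2 hr), smul_sub, smul_smul, smul_smul, phiBall]
    congr 2
    field_simp
  rw [e, norm_smul, Real.norm_eq_abs, abs_of_pos hr]
  calc _ ≤ r * (36 * ‖fderiv ℝ φ a‖ * coreWeight ‖r⁻¹ • (x - a)‖) := by gcongr
    _ = _ := by ring

/-! ### The gradient of the Oseen tensor -/

lemma hasFDerivAt_norm_E3 {x : E3} (hx : x ≠ 0) :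
    HasFDerivAt (fun z : E3 => ‖z‖) (‖x‖⁻¹ • innerSL ℝ x) x := by
  have h := (hasStrictFDerivAt_norm_sq x).hasFDerivAt.sqrt (by simpa using hx)
  simp only [Real.sqrt_sq (norm_nonneg _)] at h
  refine h.congr_fderiv ?_
  have : ‖x‖ ≠ 0 := norm_ne_zero_iff.2 hx
  rw [two_nsmul, smul_add, ← add_smul]
  congr 1
  field_simp
  norm_num

lemma oseenDeriv_eq (i j k : Fin 3) {x : E3} (hx : x ≠ 0) :
    oseenDeriv i j k x = 1 / (8 * Real.pi) *
      (-((if i = j then 1 else 0) * x k / ‖x‖ ^ 3) +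
        ((if i = k then 1 else 0) * x j + x i * (if j = k then 1 else 0)) / ‖x‖ ^ 3
        - 3 * x i * x j * x k / ‖x‖ ^ 5) := by
  have hn : ‖x‖ ≠ 0 := norm_ne_zero_iff.2 hx
  have hN := hasFDerivAt_norm_E3 hx
  have hc : ∀ l : Fin 3, HasFDerivAt (fun z : E3 => z l)
      (EuclideanSpace.proj l : E3 →L[ℝ] ℝ) x := fun l =>
    (EuclideanSpace.proj l : E3 →L[ℝ] ℝ).hasFDerivAt
  have hd := (((hasFDerivAt_const (if i = j then (1 : ℝ) else 0) x).mul
    ((hasDerivAt_inv hn).comp_hasFDerivAt x hN)).add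
    (((hc i).mul (hc j)).mul ((hasDerivAt_inv (pow_ne_zero 3 hn)).comp_hasFDerivAt x
      (hN.pow 3)))).const_mul (1 / (8 * Real.pi))
  have e : (fun z => oseen z i j) = fun z : E3 => 1 / (8 * Real.pi) *
      ((if i = j then 1 else 0) * ‖z‖⁻¹ + z i * z j * (‖z‖ ^ 3)⁻¹) := by
    funext z; simp [oseen, div_eq_mul_inv]
  rw [oseenDeriv, e]
  erw [hd.fderiv]
  clear hd e
  generalize (if i = j then (1 : ℝ) else 0) = d
  simp [EuclideanSpace.inner_single_right]
  field_simp
  split_ifs <;> field_simp <;> ring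

/-- Contracting the gradient of the Oseen tensor with a symmetric trace-free matrix. -/
lemma sum_oseenDeriv_mul {S : Matrix (Fin 3) (Fin 3) ℝ} (hsymm : ∀ i j, S i j = S j i)
    (htr : ∑ i, S i i = 0) {x : E3} (hx : x ≠ 0) (i : Fin 3) :
    ∑ j, ∑ k, oseenDeriv i j k x * S j k = -(3 / (8 * Real.pi)) * stresslet S x i := by
  simp only [oseenDeriv_eq _ _ _ hx, stresslet, quadForm, PiLp.smul_apply, smul_eq_mul]
  have hn : ‖x‖ ≠ 0 := norm_ne_zero_iff.2 hx
  have h01 := hsymm 0 1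
  have h02 := hsymm 0 2
  have h12 := hsymm 1 2
  rw [Fin.sum_univ_three] at htr
  -- Symmetry cancels the two Sx / |x|³ terms and the vanishing trace removes the third, so only the
  -- cubic term survives.
  have h22 : S 2 2 = -S 0 0 - S 1 1 := by linarith
  fin_cases i <;> simp [Fin.sum_univ_three, h01, h02, h12, h22] <;> field_simp <;> ring

/-! ### Integrable radial kernels and the Riesz-type bound for f -/

lemma integrable_coreWeight_norm : Integrable (fun x : E3 => coreWeight ‖x‖) := by
  rw [integrable_fun_norm_addHaar volume (f := coreWeight)]
  have hd : Module.finrank ℝ E3 - 1 = 2 := by simp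
  rw [hd, ← Set.Ioc_union_Ioi_eq_Ioi zero_le_one, integrableOn_union]
  constructor
  · refine (integrableOn_const (C := (1 : ℝ)) (by simp)).congr_fun (fun t ht => ?_)
      measurableSet_Ioc
    have : t ≠ 0 := ht.1.ne'
    simp [coreWeight, ht.2, this]
  · refine ((integrableOn_Ioi_rpow_of_lt (by norm_num : (-2 : ℝ) < -1)
      zero_lt_one)).congr_fun (fun t ht => ?_) measurableSet_Ioi
    have ht : (1 : ℝ) < t := ht
    have h0 : 0 < t := by linarith
    simp only [coreWeight, not_le.2 ht, if_false, smul_eq_mul]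
    rw [Real.rpow_neg h0.le]
    norm_cast
    field_simp

lemma integrableOn_inv_norm_sq_ball_zero (R : ℝ) :
    IntegrableOn (fun z : E3 => (‖z‖ ^ 2)⁻¹) (Metric.ball 0 R) := by
  rw [integrableOn_fun_norm_addHaar volume (f := fun t => (t ^ 2)⁻¹)]
  have hd : Module.finrank ℝ E3 - 1 = 2 := by simp
  rw [hd]
  refine (integrableOn_const (C := (1 : ℝ)) (by simp)).congr_fun (fun t ht => ?_)
    measurableSet_Ioo
  have : t ≠ 0 := ht.1.ne'
  simp [this]

/-- The truncated kernel `1_{|z| < R} / |z|²`. -/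
def truncInvSq (R : ℝ) : E3 → ℝ := (Metric.ball (0 : E3) R).indicator fun z => (‖z‖ ^ 2)⁻¹

lemma truncInvSq_nonneg (R : ℝ) (z : E3) : 0 ≤ truncInvSq R z :=
  Set.indicator_nonneg (fun _ _ => by positivity) z

lemma truncInvSq_of_lt {R : ℝ} {z : E3} (h : ‖z‖ < R) : truncInvSq R z = (‖z‖ ^ 2)⁻¹ :=
  Set.indicator_of_mem (mem_ball_zero_iff.2 h) _

lemma truncInvSq_of_le {R : ℝ} {z : E3} (h : R ≤ ‖z‖) : truncInvSq R z = 0 :=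
  Set.indicator_of_notMem (fun h' => not_lt.2 h (mem_ball_zero_iff.1 h')) _

lemma integrable_truncInvSq (R : ℝ) : Integrable (truncInvSq R) :=
  (integrable_indicator_iff measurableSet_ball).2 (integrableOn_inv_norm_sq_ball_zero R)

/-- Degree -2 in dimension three scales linearly in R. This makes the cut-off error below O(ε). -/
lemma integral_truncInvSq {R : ℝ} (hR : 0 < R) :
    ∫ z, truncInvSq R z = R * ∫ z, truncInvSq 1 z := by
  have h := Measure.integral_comp_inv_smul_of_nonneg (volume : Measure E3) (truncInvSq 1) hR.le
  have e : (fun x : E3 => truncInvSq 1 (R⁻¹ • x)) = fun x => R ^ 2 * truncInvSq R x := by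
    funext x
    have h1 : ‖R⁻¹ • x‖ < 1 ↔ ‖x‖ < R := by
      rw [norm_smul, norm_inv, Real.norm_eq_abs, abs_of_pos hR, inv_mul_lt_iff₀ hR, mul_one]
    rcases lt_or_ge ‖x‖ R with hx | hx
    · rw [truncInvSq_of_lt hx, truncInvSq_of_lt (h1.2 hx), norm_smul, norm_inv, Real.norm_eq_abs,
        abs_of_pos hR]
      field_simp
    · rw [truncInvSq_of_le hx, truncInvSq_of_le (not_lt.1 fun h' => not_lt.2 hx (h1.1 h')),
        mul_zero]
  rw [e, integral_const_mul] at h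
  have hd : Module.finrank ℝ E3 = 3 := by simp
  rw [hd, smul_eq_mul] at h
  have : R ^ 2 * ∫ z, truncInvSq R z = R ^ 2 * (R * ∫ z, truncInvSq 1 z) := by rw [h]; ring
  exact mul_left_cancel₀ (by positivity) this

lemma ae_norm_le_toReal {V : Type*} [NormedAddCommGroup V] {f : E3 → V} (hf : MemLp f ∞ volume) :
    ∀ᵐ x, ‖f x‖ ≤ (eLpNorm f ∞ volume).toReal := by
  filter_upwards [ae_le_eLpNormEssSup (f := f) (μ := (volume : Measure E3))] with x hx
  rw [← toReal_enorm]
  exact ENNReal.toReal_mono hf.eLpNorm_ne_top (by simpa using hx)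

/-- A bound for `∫ |f(x)| |x - y|⁻² dx`, uniform in `y`. -/
def rieszBound (f : E3 → E3) : ℝ :=
  (eLpNorm f ∞ volume).toReal * (∫ z, truncInvSq 1 z) + ∫ x, ‖f x‖

lemma rieszBound_nonneg (f : E3 → E3) : 0 ≤ rieszBound f :=
  add_nonneg (mul_nonneg ENNReal.toReal_nonneg
    (integral_nonneg fun _ => truncInvSq_nonneg _ _)) (integral_nonneg fun _ => norm_nonneg _)

lemma integrable_truncInvSq_sub (R : ℝ) (y : E3) :
    Integrable (fun x => truncInvSq R (x - y)) :=
  (integrable_truncInvSq R).comp_sub_right y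

/-- The near part is integrable and is paired with the L^∞ norm of f; the far part is at most 1 and
is paired with the L¹ norm. -/
lemma inv_norm_sq_le_truncInvSq_add (z : E3) : (‖z‖ ^ 2)⁻¹ ≤ truncInvSq 1 z + 1 := by
  by_cases hz : ‖z‖ < 1
  · rw [truncInvSq_of_lt hz]; linarith
  · have : (‖z‖ ^ 2)⁻¹ ≤ 1 := inv_le_one_of_one_le₀ (by nlinarith)
    linarith [truncInvSq_nonneg 1 z]

lemma aestronglyMeasurable_norm_mul_inv_norm_sq {f : E3 → E3} (hf : MemLp f 1 volume) (y : E3) :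
    AEStronglyMeasurable (fun x => ‖f x‖ * (‖x - y‖ ^ 2)⁻¹) :=
  hf.1.norm.mul (by fun_prop : Measurable fun x : E3 => (‖x - y‖ ^ 2)⁻¹).aestronglyMeasurable

lemma ae_norm_mul_inv_norm_sq_le {f : E3 → E3} (hf : MemLp f ∞ volume) (y : E3) :
    ∀ᵐ x, ‖f x‖ * (‖x - y‖ ^ 2)⁻¹ ≤
      (eLpNorm f ∞ volume).toReal * truncInvSq 1 (x - y) + ‖f x‖ := by
  filter_upwards [ae_norm_le_toReal hf] with x hx
  calc _ ≤ ‖f x‖ * (truncInvSq 1 (x - y) + 1) := by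
        gcongr; exact inv_norm_sq_le_truncInvSq_add _
    _ = ‖f x‖ * truncInvSq 1 (x - y) + ‖f x‖ := by ring
    _ ≤ _ := by gcongr; exact truncInvSq_nonneg _ _

lemma integrable_riesz_majorant {f : E3 → E3} (hf1 : MemLp f 1 volume) (y : E3) (M : ℝ) :
    Integrable fun x => M * truncInvSq 1 (x - y) + ‖f x‖ :=
  ((integrable_truncInvSq_sub 1 y).const_mul M).add (memLp_one_iff_integrable.1 hf1).norm

lemma integrable_norm_mul_inv_norm_sq {f : E3 → E3} (hf1 : MemLp f 1 volume)
    (hf : MemLp f ∞ volume) (y : E3) :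
    Integrable (fun x => ‖f x‖ * (‖x - y‖ ^ 2)⁻¹) := by
  refine (integrable_riesz_majorant hf1 y (eLpNorm f ∞ volume).toReal).mono'
    (aestronglyMeasurable_norm_mul_inv_norm_sq hf1 y) ?_
  filter_upwards [ae_norm_mul_inv_norm_sq_le hf y] with x hx
  rwa [Real.norm_of_nonneg (by positivity)]

lemma integral_norm_mul_inv_norm_sq_le {f : E3 → E3} (hf1 : MemLp f 1 volume)
    (hf : MemLp f ∞ volume) (y : E3) :
    ∫ x, ‖f x‖ * (‖x - y‖ ^ 2)⁻¹ ≤ rieszBound f := by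
  refine (integral_mono_ae (integrable_norm_mul_inv_norm_sq hf1 hf y)
    (integrable_riesz_majorant hf1 y _) (ae_norm_mul_inv_norm_sq_le hf y)).trans ?_
  rw [integral_add ((integrable_truncInvSq_sub 1 y).const_mul _)
    (memLp_one_iff_integrable.1 hf1).norm, integral_const_mul,
    integral_sub_right_eq_self (truncInvSq 1) y]
  rfl

/-! ### The stresslet pairing: bound and continuity -/

lemma measurable_quadForm {α : Type*} [MeasurableSpace α] {S : α → Matrix (Fin 3) (Fin 3) ℝ}
    {z : α → E3} (hS : ∀ i j, Measurable fun a => S a i j) (hz : Measurable z) :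
    Measurable fun a => quadForm (S a) (z a) := by
  have hc : ∀ i : Fin 3, Measurable fun a => z a i := fun i =>
    (EuclideanSpace.proj i : E3 →L[ℝ] ℝ).measurable.comp hz
  unfold quadForm
  exact Finset.measurable_sum _ fun i _ => Finset.measurable_sum _ fun j _ =>
    ((hS i j).mul (hc i)).mul (hc j)

lemma measurable_stresslet {α : Type*} [MeasurableSpace α] {S : α → Matrix (Fin 3) (Fin 3) ℝ}
    {z : α → E3} (hS : ∀ i j, Measurable fun a => S a i j) (hz : Measurable z) :
    Measurable fun a => stresslet (S a) (z a) :=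
  ((measurable_quadForm hS hz).div (hz.norm.pow_const 5)).smul hz

lemma continuous_quadForm {S : E3 → Matrix (Fin 3) (Fin 3) ℝ}
    (hS : ∀ i j, Continuous fun y => S y i j) (x : E3) :
    Continuous fun y => quadForm (S y) (x - y) := by
  have hc : ∀ i : Fin 3, Continuous fun y : E3 => (x - y) i := fun i =>
    ((EuclideanSpace.proj i : E3 →L[ℝ] ℝ).continuous).comp (continuous_const.sub continuous_id)
  unfold quadForm
  exact continuous_finsetSum _ fun i _ => continuous_finsetSum _ fun j _ =>
    ((hS i j).mul (hc i)).mul (hc j)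

/-- The test function `y ↦ ∫ f(x) · (S(y) : z ⊗ z) z / |z|⁵ dx`, `z = x - y`. -/
def stressletPairing (f : E3 → E3) (S : E3 → Matrix (Fin 3) (Fin 3) ℝ) (y : E3) : ℝ :=
  ∫ x, inner ℝ (f x) (stresslet (S y) (x - y))

lemma abs_inner_stresslet_le {S : Matrix (Fin 3) (Fin 3) ℝ} {s : ℝ} (hS : ∀ i j, |S i j| ≤ s)
    (v z : E3) : |inner ℝ v (stresslet S z)| ≤ 9 * s * (‖v‖ * (‖z‖ ^ 2)⁻¹) := by
  calc _ ≤ ‖v‖ * ‖stresslet S z‖ := abs_real_inner_le_norm _ _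
    _ ≤ ‖v‖ * (9 * s * (‖z‖ ^ 2)⁻¹) := by gcongr; exact norm_stresslet_le hS z
    _ = _ := by ring

lemma measurable_stresslet_sub (S : Matrix (Fin 3) (Fin 3) ℝ) (y : E3) :
    Measurable fun x : E3 => stresslet S (x - y) :=
  measurable_stresslet (fun _ _ => measurable_const) (measurable_sub_const y)

lemma integrable_inner_stresslet {f : E3 → E3} (hf1 : MemLp f 1 volume) (hf : MemLp f ∞ volume)
    (S : Matrix (Fin 3) (Fin 3) ℝ) (y : E3) :
    Integrable fun x => inner ℝ (f x) (stresslet S (x - y)) := by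
  have hS : ∀ i j, |S i j| ≤ ∑ i, ∑ j, |S i j| := fun i j =>
    (Finset.single_le_sum (f := fun j => |S i j|) (fun _ _ => abs_nonneg _)
      (Finset.mem_univ j)).trans
    (Finset.single_le_sum (f := fun i => ∑ j, |S i j|)
      (fun _ _ => Finset.sum_nonneg fun _ _ => abs_nonneg _) (Finset.mem_univ i))
  refine ((integrable_norm_mul_inv_norm_sq hf1 hf y).const_mul (9 * ∑ i, ∑ j, |S i j|)).mono'
    (hf1.1.inner (measurable_stresslet_sub S y).aestronglyMeasurable) (ae_of_all _ fun x => ?_)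
  exact abs_inner_stresslet_le hS _ _

/-- The bound s is local to y, so that |∇φ(xᵢ)|, and not just its supremum, survives in the sum over
bad indices. -/
lemma abs_stressletPairing_le {f : E3 → E3} (hf1 : MemLp f 1 volume) (hf : MemLp f ∞ volume)
    {S : E3 → Matrix (Fin 3) (Fin 3) ℝ} {s : ℝ} {y : E3} (hS : ∀ i j, |S y i j| ≤ s) :
    |stressletPairing f S y| ≤ 9 * rieszBound f * s := by
  have hs : 0 ≤ s := (abs_nonneg _).trans (hS 0 0)
  refine abs_integral_le_integral_abs.trans ?_
  refine (integral_mono (integrable_inner_stresslet hf1 hf (S y) y).abs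
    ((integrable_norm_mul_inv_norm_sq hf1 hf y).const_mul (9 * s))
    fun x => abs_inner_stresslet_le hS _ _).trans ?_
  rw [integral_const_mul]
  have := integral_norm_mul_inv_norm_sq_le hf1 hf y
  nlinarith

/-- The stresslet with its singularity cut off at distance `ε`. -/
def regStresslet (ε : ℝ) (S : Matrix (Fin 3) (Fin 3) ℝ) (z : E3) : E3 :=
  (quadForm S z / max ‖z‖ ε ^ 5) • z

lemma norm_regStresslet_le {S : Matrix (Fin 3) (Fin 3) ℝ} {s ε : ℝ} (hε : 0 < ε)
    (hS : ∀ i j, |S i j| ≤ s) (z : E3) :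
    ‖regStresslet ε S z‖ ≤ 9 * s * (max ‖z‖ ε ^ 2)⁻¹ := by
  have hs : 0 ≤ s := (abs_nonneg _).trans (hS 0 0)
  have hm : 0 < max ‖z‖ ε := lt_max_of_lt_right hε
  have hz : ‖z‖ ≤ max ‖z‖ ε := le_max_left _ _
  rw [regStresslet, norm_smul, norm_div, Real.norm_eq_abs, norm_pow, Real.norm_of_nonneg hm.le]
  calc |quadForm S z| / max ‖z‖ ε ^ 5 * ‖z‖
      ≤ 9 * s * max ‖z‖ ε ^ 2 / max ‖z‖ ε ^ 5 * max ‖z‖ ε := by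
        gcongr
        exact (abs_quadForm_le hS z).trans (by gcongr)
    _ = _ := by field_simp

lemma norm_stresslet_sub_regStresslet_le {S : Matrix (Fin 3) (Fin 3) ℝ} {s ε : ℝ} (hε : 0 < ε)
    (hS : ∀ i j, |S i j| ≤ s) (z : E3) :
    ‖stresslet S z - regStresslet ε S z‖ ≤ 18 * s * truncInvSq ε z := by
  have hs : 0 ≤ s := (abs_nonneg _).trans (hS 0 0)
  by_cases hz : ‖z‖ < ε
  · rcases eq_or_ne z 0 with rfl | h0
    · simpa [stresslet, regStresslet] using mul_nonneg (by positivity) (truncInvSq_nonneg ε 0)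
    have h0 : 0 < ‖z‖ := norm_pos_iff.2 h0
    have h1 := norm_stresslet_le hS z
    have h2 := norm_regStresslet_le hε hS z
    have h3 : (max ‖z‖ ε ^ 2)⁻¹ ≤ (‖z‖ ^ 2)⁻¹ := by gcongr; exact le_max_left _ _
    have h4 : 9 * s * (max ‖z‖ ε ^ 2)⁻¹ ≤ 9 * s * (‖z‖ ^ 2)⁻¹ := by gcongr
    have h5 := norm_sub_le (stresslet S z) (regStresslet ε S z)
    rw [truncInvSq_of_lt hz]
    linarith
  · have : max ‖z‖ ε = ‖z‖ := max_eq_left (not_lt.1 hz)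
    simp [stresslet, regStresslet, this, truncInvSq_of_le (not_lt.1 hz)]

/-- Cutting the singularity off at ε gives a kernel bounded by a multiple of ε⁻², so dominated
convergence yields continuity. The cut-off error is O(ε) uniformly in y, and uniform limits preserve
continuity. -/
lemma continuous_stressletPairing {f : E3 → E3} (hf1 : MemLp f 1 volume) (hf : MemLp f ∞ volume)
    {S : E3 → Matrix (Fin 3) (Fin 3) ℝ} (hS : ∀ i j, Continuous fun y => S y i j) {s : ℝ}
    (hs : ∀ y i j, |S y i j| ≤ s) : Continuous (stressletPairing f S) := by
  have hs0 : 0 ≤ s := (abs_nonneg _).trans (hs 0 0 0)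
  have hfi := memLp_one_iff_integrable.1 hf1
  have hmeas : ∀ ε y, AEStronglyMeasurable
      (fun x => inner ℝ (f x) (regStresslet ε (S y) (x - y))) := fun ε y => by
    refine hf1.1.inner (Measurable.aestronglyMeasurable ?_)
    have hq : Measurable fun x : E3 => quadForm (S y) (x - y) :=
      measurable_quadForm (fun _ _ => measurable_const) (measurable_sub_const y)
    unfold regStresslet
    fun_prop
  have hbd : ∀ ε, 0 < ε → ∀ y x, ‖inner ℝ (f x) (regStresslet ε (S y) (x - y))‖ ≤
      9 * s * (ε ^ 2)⁻¹ * ‖f x‖ := fun ε hε y x => by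
    calc _ ≤ ‖f x‖ * ‖regStresslet ε (S y) (x - y)‖ := norm_inner_le_norm _ _
      _ ≤ ‖f x‖ * (9 * s * (ε ^ 2)⁻¹) := by
        gcongr
        refine (norm_regStresslet_le hε (hs y) _).trans ?_
        gcongr
        exact le_max_right _ _
      _ = _ := by ring
  have hcont : ∀ ε, 0 < ε →
      Continuous fun y => ∫ x, inner ℝ (f x) (regStresslet ε (S y) (x - y)) := fun ε hε => by
    refine continuous_of_dominated (hmeas ε) (fun y => ae_of_all _ (hbd ε hε y))
      (hfi.norm.const_mul _) (ae_of_all _ fun x => ?_)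
    refine continuous_const.inner (((continuous_quadForm hS x).div (by fun_prop) fun y => ?_).smul
      (by fun_prop))
    exact (pow_pos (lt_max_of_lt_right hε) _).ne'
  have hdiff : ∀ ε, 0 < ε → ∀ y,
      |stressletPairing f S y - ∫ x, inner ℝ (f x) (regStresslet ε (S y) (x - y))| ≤
        18 * s * (eLpNorm f ∞ volume).toReal * (∫ z, truncInvSq 1 z) * ε := fun ε hε y => by
    have hi2 : Integrable fun x => inner ℝ (f x) (regStresslet ε (S y) (x - y)) :=
      (hfi.norm.const_mul _).mono' (hmeas ε y) (ae_of_all _ (hbd ε hε y))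
    have hi1 := integrable_inner_stresslet hf1 hf (S y) y
    rw [stressletPairing, ← integral_sub hi1 hi2]
    refine abs_integral_le_integral_abs.trans ?_
    refine (integral_mono_ae (hi1.sub hi2).abs ((integrable_truncInvSq_sub ε y).const_mul
      (18 * s * (eLpNorm f ∞ volume).toReal)) ?_).trans ?_
    · filter_upwards [ae_norm_le_toReal hf] with x hx
      rw [Pi.sub_apply, ← inner_sub_right]
      calc _ ≤ ‖f x‖ * ‖stresslet (S y) (x - y) - regStresslet ε (S y) (x - y)‖ :=
            abs_real_inner_le_norm _ _
        _ ≤ (eLpNorm f ∞ volume).toReal * (18 * s * truncInvSq ε (x - y)) := by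
          gcongr; exact norm_stresslet_sub_regStresslet_le hε (hs y) _
        _ = _ := by ring
    · rw [integral_const_mul, integral_sub_right_eq_self (truncInvSq ε) y, integral_truncInvSq hε]
      apply le_of_eq; ring
  have hunif : TendstoUniformly
      (fun (ε : ℝ) y => ∫ x, inner ℝ (f x) (regStresslet ε (S y) (x - y)))
      (stressletPairing f S) (𝓝[>] 0) := by
    rw [Metric.tendstoUniformly_iff]
    intro δ hδ
    have hl : Tendsto (fun ε : ℝ => 18 * s * (eLpNorm f ∞ volume).toReal *
        (∫ z, truncInvSq 1 z) * ε) (𝓝[>] 0) (𝓝 0) := by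
      have : Tendsto (fun ε : ℝ => 18 * s * (eLpNorm f ∞ volume).toReal *
        (∫ z, truncInvSq 1 z) * ε) (𝓝 0) (𝓝 _) := (continuous_const.mul continuous_id).tendsto 0
      simpa using this.mono_left nhdsWithin_le_nhds
    filter_upwards [hl.eventually (gt_mem_nhds hδ), self_mem_nhdsWithin] with ε h1 h2 y
    exact (hdiff ε h2 y).trans_lt h1
  exact hunif.continuous
    (Eventually.frequently (by filter_upwards [self_mem_nhdsWithin] with ε h using hcont ε h))

/-! ### Potentials of balls and their decay -/

/-- The decay profile `(1 + |x|)⁻²` of the first derivatives of the Oseen tensor. -/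
def decay (x : E3) : ℝ := ((1 + ‖x‖) ^ 2)⁻¹

lemma decay_nonneg (x : E3) : 0 ≤ decay x := by unfold decay; positivity

lemma memLp_decay : MemLp decay 6 volume := by
  have hm : AEStronglyMeasurable decay volume := by
    unfold decay
    exact (by fun_prop : Measurable fun x : E3 => ((1 + ‖x‖) ^ 2)⁻¹).aestronglyMeasurable
  rw [← integrable_norm_rpow_iff hm (by norm_num) (by norm_num)]
  -- The exponent 12 = 6 · 2 exceeds the dimension 3.
  refine (integrable_one_add_norm (E := E3) (μ := volume) (r := 12) (by simp; norm_num)).congr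
    (ae_of_all _ fun x => ?_)
  have hx : 0 < 1 + ‖x‖ := by positivity
  have h6 : (6 : ℝ≥0∞).toReal = 6 := by simp
  simp only [h6]
  rw [Real.rpow_neg hx.le]
  rw [Real.norm_of_nonneg (decay_nonneg x), decay]
  norm_cast
  rw [inv_pow, ← pow_mul]

/-- The potential `∫_{|y| < R} |x - y|⁻² dy`. -/
def ballPotential (R : ℝ) (x : E3) : ℝ := ∫ y in Metric.ball 0 R, (‖x - y‖ ^ 2)⁻¹

lemma integrable_truncInvSq_sub_left (R : ℝ) (x : E3) :
    Integrable (fun y => truncInvSq R (x - y)) :=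
  (integrable_truncInvSq R).comp_sub_left x

lemma integrableOn_inv_norm_sub_sq (R : ℝ) (x : E3) :
    IntegrableOn (fun y => (‖x - y‖ ^ 2)⁻¹) (Metric.ball 0 R) := by
  refine Integrable.mono' (g := fun y => truncInvSq 1 (x - y) + 1)
    ((integrable_truncInvSq_sub_left 1 x).integrableOn.add (integrableOn_const measure_ball_lt_top.ne))
    (by fun_prop : Measurable fun y : E3 => (‖x - y‖ ^ 2)⁻¹).aestronglyMeasurable
    (ae_of_all _ fun y => ?_)
  rw [Real.norm_of_nonneg (by positivity)]
  exact inv_norm_sq_le_truncInvSq_add _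

lemma exists_ballPotential_le {R : ℝ} (hR : 1 ≤ R) :
    ∃ C, 0 ≤ C ∧ ∀ x, ballPotential R x ≤ C * decay x := by
  set N := ∫ z, truncInvSq 1 z
  have hN : 0 ≤ N := integral_nonneg fun _ => truncInvSq_nonneg _ _
  set V := (volume : Measure E3).real (Metric.ball 0 R)
  have hV : 0 ≤ V := measureReal_nonneg
  refine ⟨3 * R * N * (1 + 2 * R) ^ 2 + 16 * V, by positivity, fun x => ?_⟩
  rcases le_or_gt ‖x‖ (2 * R) with hx | hx
  · have h1 : ballPotential R x ≤ 3 * R * N := by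
      calc ballPotential R x ≤ ∫ y in Metric.ball 0 R, truncInvSq (3 * R) (x - y) := by
            refine setIntegral_mono_on (integrableOn_inv_norm_sub_sq R x)
              (integrable_truncInvSq_sub_left _ x).integrableOn measurableSet_ball fun y hy => ?_
            rw [truncInvSq_of_lt]
            have := mem_ball_zero_iff.1 hy
            linarith [norm_sub_le x y]
        _ ≤ ∫ y, truncInvSq (3 * R) (x - y) :=
            setIntegral_le_integral (integrable_truncInvSq_sub_left _ x)
              (ae_of_all _ fun y => truncInvSq_nonneg _ _)
        _ = 3 * R * N := by
            rw [integral_sub_left_eq_self, integral_truncInvSq (by linarith)]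
    have h2 : 1 ≤ (1 + 2 * R) ^ 2 * decay x := by
      unfold decay
      rw [← div_eq_mul_inv, one_le_div (by positivity)]
      gcongr
    have h3 : 0 ≤ 16 * V * decay x := mul_nonneg (by positivity) (decay_nonneg x)
    have h4 : 3 * R * N * 1 ≤ 3 * R * N * ((1 + 2 * R) ^ 2 * decay x) := by gcongr
    nlinarith
  · have h1 : ballPotential R x ≤ ∫ _y in Metric.ball (0 : E3) R, 16 * decay x := by
      refine setIntegral_mono_on (integrableOn_inv_norm_sub_sq R x)
        (integrableOn_const measure_ball_lt_top.ne) measurableSet_ball fun y hy => ?_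
      have hy := mem_ball_zero_iff.1 hy
      -- Here |y| < R < |x|/2, so |x - y| > |x|/2, which is at least (1 + |x|)/4 because |x| ≥ 1.
      have h2 : (1 + ‖x‖) / 4 ≤ ‖x - y‖ := by linarith [norm_sub_norm_le x y]
      calc (‖x - y‖ ^ 2)⁻¹ ≤ (((1 + ‖x‖) / 4) ^ 2)⁻¹ := by gcongr
        _ = 16 * decay x := by unfold decay; field_simp; norm_num
    rw [setIntegral_const, smul_eq_mul] at h1
    have h3 : 0 ≤ 3 * R * N * (1 + 2 * R) ^ 2 * decay x :=
      mul_nonneg (by positivity) (decay_nonneg x)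
    linarith

lemma volume_real_ball (a : E3) {r : ℝ} (hr : 0 ≤ r) :
    (volume : Measure E3).real (Metric.ball a r) = 4 * Real.pi / 3 * r ^ 3 := by
  rw [measureReal_def, EuclideanSpace.volume_ball_fin_three, ENNReal.toReal_mul,
    ENNReal.toReal_pow, ENNReal.toReal_ofReal hr, ENNReal.toReal_ofReal (by positivity)]
  ring

lemma integrableOn_ball_inv_norm_sub_sq (a : E3) (r : ℝ) (x : E3) :
    IntegrableOn (fun y => (‖x - y‖ ^ 2)⁻¹) (Metric.ball a r) :=
  (integrableOn_inv_norm_sub_sq (r + ‖a‖) x).mono_set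
    (Metric.ball_subset_ball' (by simp))

/-- On the ball, |x - y| ≤ 2 max(|x - a|, r); the lost factor 4 is recovered from the volume, as
4π/3 ≥ 4. Single-ball bounds thereby become integrals over disjoint balls, which add up without
dependence on n. -/
lemma cube_mul_inv_max_sq_le (a x : E3) {r : ℝ} (hr : 0 < r) :
    r ^ 3 * (max ‖x - a‖ r ^ 2)⁻¹ ≤ ∫ y in Metric.ball a r, (‖x - y‖ ^ 2)⁻¹ := by
  have hm : 0 < max ‖x - a‖ r := lt_max_of_lt_right hr
  have h1 : ∫ _y in Metric.ball a r, ((2 * max ‖x - a‖ r) ^ 2)⁻¹ ≤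
      ∫ y in Metric.ball a r, (‖x - y‖ ^ 2)⁻¹ := by
    refine setIntegral_mono_on_ae (integrableOn_const measure_ball_lt_top.ne)
      (integrableOn_ball_inv_norm_sub_sq a r x) measurableSet_ball ?_
    -- The point y = x must be excluded: there the inverse is 0 by convention and the lower bound
    -- fails.
    filter_upwards [Measure.ae_ne volume x] with y hyx hy
    have h0 : 0 < ‖x - y‖ := norm_pos_iff.2 (sub_ne_zero.2 hyx.symm)
    have h2 : ‖x - y‖ ≤ ‖x - a‖ + ‖a - y‖ := norm_sub_le_norm_sub_add_norm_sub x a y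
    have h3 : ‖a - y‖ < r := by rwa [← dist_eq_norm, dist_comm]
    have h4 := le_max_left ‖x - a‖ r
    have h5 := le_max_right ‖x - a‖ r
    gcongr
    linarith
  rw [setIntegral_const, volume_real_ball a hr.le, smul_eq_mul] at h1
  refine le_trans ?_ h1
  have hpi := Real.pi_gt_three
  calc r ^ 3 * (max ‖x - a‖ r ^ 2)⁻¹ = 4 * 3 / 3 * r ^ 3 * ((2 * max ‖x - a‖ r) ^ 2)⁻¹ := by
        field_simp; norm_num
    _ ≤ _ := by gcongr

/-- A sum over disjoint small balls of single-ball far fields is bounded by a potential. -/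
lemma norm_sum_phiBall_le {φ : E3 → E3} {s R r₁ r : ℝ} (hs : ∀ y, ‖fderiv ℝ φ y‖ ≤ s)
    (hR : ∀ y, R ≤ ‖y‖ → fderiv ℝ φ y = 0) (hr : 0 < r) (hr₁ : r ≤ r₁) {n : ℕ} {X : Fin n → E3}
    (hX : ∀ i j, i ≠ j → 2 * r ≤ ‖X i - X j‖) (G : Finset (Fin n)) (x : E3) :
    ‖∑ i ∈ G, phiBall φ r (X i) x‖ ≤ 54 * s * ballPotential (R + r₁) x := by
  classical
  have hs0 : 0 ≤ s := (norm_nonneg _).trans (hs 0)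
  -- Centres outside the support of ∇φ contribute nothing; the other balls lie in the ball of radius
  -- R + r₁.
  set G' := G.filter fun i => ‖X i‖ < R
  have h1 : ‖∑ i ∈ G, phiBall φ r (X i) x‖ ≤
      ∑ i ∈ G', 54 * s * ∫ y in Metric.ball (X i) r, (‖x - y‖ ^ 2)⁻¹ := by
    refine (norm_sum_le _ _).trans ?_
    rw [Finset.sum_filter]
    refine Finset.sum_le_sum fun i _ => ?_
    have h := norm_phiBall_le φ hr (X i) x
    split_ifs with hi
    · refine h.trans ?_
      gcongr
      · exact hs _
      · exact cube_mul_inv_max_sq_le _ _ hr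
    · rw [hR _ (not_lt.1 hi)] at h
      simpa using h
  refine h1.trans ?_
  rw [← Finset.mul_sum]
  gcongr
  rw [← integral_biUnion_finset G' (fun _ _ => measurableSet_ball) (fun i _ j _ hij => ?_)
    fun i _ => integrableOn_ball_inv_norm_sub_sq _ _ _]
  · refine setIntegral_mono_set (integrableOn_inv_norm_sub_sq _ x)
      (ae_of_all _ fun _ => by positivity) (LE.le.eventuallyLE ?_)
    refine Set.iUnion₂_subset fun i hi => Metric.ball_subset_ball' ?_
    have := (Finset.mem_filter.1 hi).2
    rw [dist_zero_right]
    linarith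
  · refine Metric.ball_disjoint_ball ?_
    rw [dist_eq_norm]
    linarith [hX i j hij]

/-! ### The symmetric gradient -/

section SymGrad

variable {φ : E3 → E3}

lemma continuous_symGrad (hφ : ContDiff ℝ ∞ φ) (i j : Fin 3) :
    Continuous fun y => symGrad φ y i j := by
  have h : ∀ k l, Continuous (partialDeriv φ k l) := fun k l =>
    (EuclideanSpace.proj l : E3 →L[ℝ] ℝ).continuous.comp
      ((hφ.continuous_fderiv (by simp)).clm_apply continuous_const)
  simp only [symGrad, Matrix.of_apply]
  exact ((h j i).add (h i j)).div_const 2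

lemma symGrad_symm (y : E3) (i j : Fin 3) : symGrad φ y i j = symGrad φ y j i := by
  simp [symGrad, add_comm]

lemma symGrad_trace (hdiv : ∀ x, divergence φ x = 0) (y : E3) : ∑ i, symGrad φ y i i = 0 := by
  rw [← hdiv y]
  simp [symGrad, divergence]

lemma symGrad_eq_zero {y : E3} (h : fderiv ℝ φ y = 0) : symGrad φ y = 0 := by
  ext i j
  simp [symGrad, partialDeriv, h]

end SymGrad

lemma stresslet_zero_left (z : E3) : stresslet 0 z = 0 := by simp [stresslet, quadForm]

/-! ### The whole-space part as a superposition of stresslets -/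

section Free

variable {φ : E3 → E3} {ρ : E3 → ℝ} {s R : ℝ}

lemma aestronglyMeasurable_smul_stresslet (hφ : ContDiff ℝ ∞ φ) (hρ : MemLp ρ ∞ volume) :
    AEStronglyMeasurable
      (fun q : E3 × E3 => ρ q.2 • stresslet (symGrad φ q.2) (q.1 - q.2))
      ((volume : Measure E3).prod volume) :=
  hρ.1.comp_snd.smul
    (measurable_stresslet (fun i j => (continuous_symGrad hφ i j).measurable.comp measurable_snd)
      (measurable_fst.sub measurable_snd)).aestronglyMeasurable

lemma measurable_stresslet_sub_left (hφ : ContDiff ℝ ∞ φ) (x : E3) :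
    Measurable fun y => stresslet (symGrad φ y) (x - y) :=
  measurable_stresslet (fun i j => (continuous_symGrad hφ i j).measurable)
    (measurable_const_sub x)

lemma ae_norm_smul_stresslet_le (hs : ∀ y, ‖fderiv ℝ φ y‖ ≤ s)
    (hR : ∀ y, R ≤ ‖y‖ → fderiv ℝ φ y = 0) (hρ : MemLp ρ ∞ volume) (x : E3) :
    ∀ᵐ y, ‖ρ y • stresslet (symGrad φ y) (x - y)‖ ≤ (Metric.ball (0 : E3) R).indicator
      (fun y => (eLpNorm ρ ∞ volume).toReal * (9 * s) * (‖x - y‖ ^ 2)⁻¹) y := by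
  filter_upwards [ae_norm_le_toReal hρ] with y hy
  by_cases h : ‖y‖ < R
  · rw [Set.indicator_of_mem (mem_ball_zero_iff.2 h), norm_smul, mul_assoc]
    gcongr
    exact norm_stresslet_le (fun i j => (abs_symGrad_le φ y i j).trans (hs y)) _
  · rw [symGrad_eq_zero (hR y (not_lt.1 h)), stresslet_zero_left, smul_zero, norm_zero]
    have hs0 : 0 ≤ s := (norm_nonneg _).trans (hs 0)
    exact Set.indicator_nonneg (fun _ _ => by positivity) y

lemma integrable_indicator_inv_norm_sq (R c : ℝ) (x : E3) :
    Integrable ((Metric.ball (0 : E3) R).indicator (fun y => c * (‖x - y‖ ^ 2)⁻¹)) :=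
  (integrable_indicator_iff measurableSet_ball).2
    ((integrableOn_inv_norm_sub_sq R x).const_mul c)

lemma integrable_smul_stresslet (hφ : ContDiff ℝ ∞ φ) (hs : ∀ y, ‖fderiv ℝ φ y‖ ≤ s)
    (hR : ∀ y, R ≤ ‖y‖ → fderiv ℝ φ y = 0) (hρ : MemLp ρ ∞ volume) (x : E3) :
    Integrable fun y => ρ y • stresslet (symGrad φ y) (x - y) :=
  (integrable_indicator_inv_norm_sq R _ x).mono'
    (hρ.1.smul (measurable_stresslet_sub_left hφ x).aestronglyMeasurable)
    (ae_norm_smul_stresslet_le hs hR hρ x)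

/-- The whole-space part is a superposition of stresslets with density `-15 λ ρ / 8π`. -/
lemma phiFree_eq (hφ : ContDiff ℝ ∞ φ) (hdiv : ∀ x, divergence φ x = 0)
    (hs : ∀ y, ‖fderiv ℝ φ y‖ ≤ s) (hR : ∀ y, R ≤ ‖y‖ → fderiv ℝ φ y = 0)
    (hρ : MemLp ρ ∞ volume) (lam : ℝ) (x : E3) :
    phiFree lam ρ φ x =
      -(15 * lam / (8 * Real.pi)) • ∫ y, ρ y • stresslet (symGrad φ y) (x - y) := by
  ext i
  have h := (EuclideanSpace.proj i : E3 →L[ℝ] ℝ).integral_comp_comm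
    (integrable_smul_stresslet hφ hs hR hρ x)
  rw [PiLp.smul_apply, smul_eq_mul]
  change _ = _ * (EuclideanSpace.proj i : E3 →L[ℝ] ℝ) _
  rw [← h, ← integral_const_mul]
  refine integral_congr_ae ?_
  filter_upwards [Measure.ae_ne volume x] with y hy
  have h1 := sum_oseenDeriv_mul (fun j k => symGrad_symm (φ := φ) y j k) (symGrad_trace hdiv y)
    (sub_ne_zero.2 hy.symm) i
  have h2 : ∀ j k, oseenDeriv i j k (x - y) * ((5 * lam * ρ y) • symGrad φ y) j k =
      (5 * lam * ρ y) * (oseenDeriv i j k (x - y) * symGrad φ y j k) := fun j k => by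
    simp only [Matrix.smul_apply, smul_eq_mul]; ring
  have h3 : (EuclideanSpace.proj i : E3 →L[ℝ] ℝ) (ρ y • stresslet (symGrad φ y) (x - y)) =
      ρ y * stresslet (symGrad φ y) (x - y) i := rfl
  simp only [h2, ← Finset.mul_sum, h1, h3]
  ring

lemma norm_phiFree_le (hφ : ContDiff ℝ ∞ φ) (hdiv : ∀ x, divergence φ x = 0)
    (hs : ∀ y, ‖fderiv ℝ φ y‖ ≤ s) (hR : ∀ y, R ≤ ‖y‖ → fderiv ℝ φ y = 0)
    (hρ : MemLp ρ ∞ volume) (lam : ℝ) (x : E3) :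
    ‖phiFree lam ρ φ x‖ ≤ |15 * lam / (8 * Real.pi)| *
      ((eLpNorm ρ ∞ volume).toReal * (9 * s)) * ballPotential R x := by
  rw [phiFree_eq hφ hdiv hs hR hρ, norm_smul, norm_neg, Real.norm_eq_abs, mul_assoc]
  gcongr
  refine (norm_integral_le_of_norm_le (integrable_indicator_inv_norm_sq R _ x)
    (ae_norm_smul_stresslet_le hs hR hρ x)).trans ?_
  rw [integral_indicator measurableSet_ball, integral_const_mul, ballPotential]

lemma aestronglyMeasurable_phiFree (hφ : ContDiff ℝ ∞ φ) (hdiv : ∀ x, divergence φ x = 0)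
    (hs : ∀ y, ‖fderiv ℝ φ y‖ ≤ s) (hR : ∀ y, R ≤ ‖y‖ → fderiv ℝ φ y = 0)
    (hρ : MemLp ρ ∞ volume) (lam : ℝ) : AEStronglyMeasurable (phiFree lam ρ φ) volume := by
  have h : phiFree lam ρ φ = fun x =>
      -(15 * lam / (8 * Real.pi)) • ∫ y, ρ y • stresslet (symGrad φ y) (x - y) :=
    funext fun x => phiFree_eq hφ hdiv hs hR hρ lam x
  rw [h]
  exact AEStronglyMeasurable.const_smul
    (aestronglyMeasurable_smul_stresslet hφ hρ).integral_prod_right' (_ : ℝ)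

lemma integral_inner_phiFree (hφ : ContDiff ℝ ∞ φ) (hdiv : ∀ x, divergence φ x = 0)
    (hs : ∀ y, ‖fderiv ℝ φ y‖ ≤ s) (hR : ∀ y, R ≤ ‖y‖ → fderiv ℝ φ y = 0)
    (hρ : MemLp ρ ∞ volume) (lam : ℝ) {f : E3 → E3} (hf1 : MemLp f 1 volume)
    (hf : MemLp f ∞ volume) :
    ∫ x, inner ℝ (f x) (phiFree lam ρ φ x) =
      -(15 * lam / (8 * Real.pi)) * ∫ y, stressletPairing f (symGrad φ) y * ρ y := by
  have h1 : ∀ x, inner ℝ (f x) (phiFree lam ρ φ x) = -(15 * lam / (8 * Real.pi)) *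
      ∫ y, inner ℝ (f x) (ρ y • stresslet (symGrad φ y) (x - y)) := fun x => by
    rw [phiFree_eq hφ hdiv hs hR hρ, inner_smul_right,
      integral_inner (integrable_smul_stresslet hφ hs hR hρ x)]
  simp only [h1]
  rw [integral_const_mul]
  congr 1
  have hmeas : AEStronglyMeasurable (Function.uncurry fun x y : E3 =>
      (inner ℝ (f x) (ρ y • stresslet (symGrad φ y) (x - y)) : ℝ))
      ((volume : Measure E3).prod volume) :=
    hf1.1.comp_fst.inner (aestronglyMeasurable_smul_stresslet hφ hρ)
  have hsec : ∀ y, Integrable fun x => (inner ℝ (f x) (ρ y • stresslet (symGrad φ y) (x - y)) : ℝ) :=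
    fun y => by
      simpa only [inner_smul_right] using
        (integrable_inner_stresslet hf1 hf (symGrad φ y) y).const_mul (ρ y)
  rw [integral_integral_swap]
  · refine integral_congr_ae (ae_of_all _ fun y => ?_)
    simp only [inner_smul_right, stressletPairing]
    rw [integral_const_mul, mul_comm]
  -- Integrating in x first gives the Riesz bound, uniform in y; the support of ∇φ then confines y
  -- to a ball.
  · refine (integrable_prod_iff' hmeas).2 ⟨ae_of_all _ hsec, ?_⟩
    refine Integrable.mono' (g := (Metric.ball (0 : E3) R).indicator fun _ =>
      (eLpNorm ρ ∞ volume).toReal * (9 * s * rieszBound f))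
      ((integrable_indicator_iff measurableSet_ball).2 (integrableOn_const measure_ball_lt_top.ne))
      hmeas.norm.prod_swap.integral_prod_right' ?_
    filter_upwards [ae_norm_le_toReal hρ] with y hy
    rw [Real.norm_eq_abs] at hy
    rw [Real.norm_of_nonneg (integral_nonneg fun _ => norm_nonneg _)]
    by_cases h : ‖y‖ < R
    · have hs0 : 0 ≤ s := (norm_nonneg _).trans (hs 0)
      rw [Set.indicator_of_mem (mem_ball_zero_iff.2 h)]
      calc _ ≤ ∫ x, |ρ y| * (9 * s) * (‖f x‖ * (‖x - y‖ ^ 2)⁻¹) := by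
            refine integral_mono (hsec y).norm
              ((integrable_norm_mul_inv_norm_sq hf1 hf y).const_mul _) fun x => ?_
            change ‖(inner ℝ (f x) (ρ y • stresslet (symGrad φ y) (x - y)) : ℝ)‖ ≤ _
            rw [inner_smul_right, norm_mul, Real.norm_eq_abs, Real.norm_eq_abs, mul_assoc]
            gcongr
            exact abs_inner_stresslet_le (fun i j => (abs_symGrad_le φ y i j).trans (hs y)) _ _
        _ ≤ (eLpNorm ρ ∞ volume).toReal * (9 * s) * rieszBound f := by
            rw [integral_const_mul]
            gcongr
            exact integral_norm_mul_inv_norm_sq_le hf1 hf y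
        _ = _ := by ring
    · rw [Set.indicator_of_notMem (fun h' => h (mem_ball_zero_iff.1 h'))]
      simp [Function.uncurry, symGrad_eq_zero (hR y (not_lt.1 h)), stresslet_zero_left]

end Free

/-! ### Single-ball corrections tested against f -/

lemma measurable_ballFlow (S : Matrix (Fin 3) (Fin 3) ℝ) : Measurable (ballFlow S) := by
  have hq : Measurable (quadForm S) := measurable_quadForm (fun _ _ => measurable_const) measurable_id
  have hv : Measurable (matVec S) := by
    have hc : ∀ i : Fin 3, Measurable fun z : E3 => z i := fun i =>
      (EuclideanSpace.proj i : E3 →L[ℝ] ℝ).measurable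
    unfold matVec
    exact (WithLp.measurable_toLp 2 _).comp (measurable_pi_lambda _ fun i =>
      Finset.measurable_sum _ fun j _ => measurable_const.mul (hc j))
  unfold ballFlow
  refine Measurable.ite (measurableSet_le measurable_norm measurable_const) hv ?_
  fun_prop

lemma measurable_phiBall (φ : E3 → E3) (r : ℝ) (a : E3) : Measurable (phiBall φ r a) := by
  have h : Measurable fun x : E3 => ballFlow (symGrad φ a) (r⁻¹ • (x - a)) :=
    (measurable_ballFlow _).comp ((measurable_sub_const a).const_smul r⁻¹)
  exact h.const_smul r

lemma integrable_coreWeight_rescaled {r : ℝ} (hr : 0 < r) (a : E3) :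
    Integrable fun x : E3 => coreWeight ‖r⁻¹ • (x - a)‖ :=
  (integrable_coreWeight_norm.comp_smul (inv_ne_zero hr.ne')).comp_sub_right a

lemma integral_coreWeight_rescaled {r : ℝ} (hr : 0 < r) (a : E3) :
    ∫ x : E3, coreWeight ‖r⁻¹ • (x - a)‖ = r ^ 3 * ∫ x : E3, coreWeight ‖x‖ := by
  rw [integral_sub_right_eq_self (fun x : E3 => coreWeight ‖r⁻¹ • x‖) a,
    Measure.integral_comp_inv_smul_of_nonneg volume (fun x : E3 => coreWeight ‖x‖) hr.le]
  simp

/-- Against a bounded integrable field, a single-ball correction acts like a stresslet of strength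
`5 r³ / 2`, up to an error of order `r⁴`. -/
lemma integrable_inner_phiBall_and_abs_sub_le {f : E3 → E3} (hf1 : MemLp f 1 volume)
    (hf : MemLp f ∞ volume) (φ : E3 → E3) {r : ℝ} (hr : 0 < r) (a : E3) :
    Integrable (fun x => inner ℝ (f x) (phiBall φ r a x)) ∧
    |(∫ x, inner ℝ (f x) (phiBall φ r a x)) - 5 / 2 * r ^ 3 * stressletPairing f (symGrad φ) a| ≤
      (eLpNorm f ∞ volume).toReal * 36 * (∫ x : E3, coreWeight ‖x‖) * ‖fderiv ℝ φ a‖ * r ^ 4 := by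
  set M := (eLpNorm f ∞ volume).toReal
  have hM : 0 ≤ M := ENNReal.toReal_nonneg
  have hmaj := (integrable_coreWeight_rescaled hr a).const_mul (M * 36 * ‖fderiv ℝ φ a‖ * r)
  have hst := (integrable_inner_stresslet hf1 hf (symGrad φ a) a).const_mul (5 / 2 * r ^ 3)
  have hb : ∀ᵐ x, ‖(inner ℝ (f x) (phiBall φ r a x - (5 / 2 * r ^ 3) •
      stresslet (symGrad φ a) (x - a)) : ℝ)‖ ≤
      M * 36 * ‖fderiv ℝ φ a‖ * r * coreWeight ‖r⁻¹ • (x - a)‖ := by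
    filter_upwards [ae_norm_le_toReal hf] with x hx
    calc _ ≤ ‖f x‖ * ‖phiBall φ r a x - (5 / 2 * r ^ 3) • stresslet (symGrad φ a) (x - a)‖ :=
          norm_inner_le_norm _ _
      _ ≤ M * (36 * ‖fderiv ℝ φ a‖ * (r * coreWeight ‖r⁻¹ • (x - a)‖)) := by
          gcongr; exact norm_phiBall_sub_stresslet_le φ hr a x
      _ = _ := by ring
  have hmeas : Measurable fun x => phiBall φ r a x - (5 / 2 * r ^ 3) •
      stresslet (symGrad φ a) (x - a) := by
    have h1 := measurable_phiBall φ r a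
    have h2 := measurable_stresslet_sub (symGrad φ a) a
    have h3 : Measurable fun x : E3 => (5 / 2 * r ^ 3) • stresslet (symGrad φ a) (x - a) :=
      Measurable.const_smul h2 (5 / 2 * r ^ 3)
    exact Measurable.sub h1 h3
  have herr : Integrable fun x => (inner ℝ (f x) (phiBall φ r a x - (5 / 2 * r ^ 3) •
      stresslet (symGrad φ a) (x - a)) : ℝ) :=
    hmaj.mono' (hf1.1.inner hmeas.aestronglyMeasurable) hb
  have hsplit : ∀ x, (inner ℝ (f x) (phiBall φ r a x) : ℝ) =
      inner ℝ (f x) (phiBall φ r a x - (5 / 2 * r ^ 3) • stresslet (symGrad φ a) (x - a)) +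
      5 / 2 * r ^ 3 * inner ℝ (f x) (stresslet (symGrad φ a) (x - a)) := fun x => by
    rw [inner_sub_right, inner_smul_right]; ring
  simp only [hsplit]
  refine ⟨herr.add hst, ?_⟩
  rw [integral_add herr hst, integral_const_mul, stressletPairing, add_sub_cancel_right]
  refine (norm_integral_le_of_norm_le hmaj hb).trans ?_
  -- The prefactor r times the rescaled volume r³ gives r⁴.
  rw [integral_const_mul, integral_coreWeight_rescaled hr a]
  apply le_of_eq; ring

/-! ### Duality between L^{6/5} and L⁶ -/

instance holderTriple_six_fifths : ENNReal.HolderTriple (6 / 5) 6 1 where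
  inv_add_inv_eq_inv := by
    rw [ENNReal.inv_div (by simp) (by simp), ← one_div, ENNReal.div_add_div_same]
    norm_num
    exact ENNReal.div_self (by norm_num) (by norm_num)

/-- Hölder's inequality against a field dominated by `decay`. -/
lemma integrable_inner_and_abs_le_of_decay {g u : E3 → E3} {C : ℝ}
    (hg : MemLp g (6 / 5) volume) (hu : AEStronglyMeasurable u volume)
    (hC : ∀ x, ‖u x‖ ≤ C * decay x) :
    Integrable (fun x => inner ℝ (g x) (u x)) ∧
    |∫ x, inner ℝ (g x) (u x)| ≤
      (eLpNorm (fun x => C * decay x) 6 volume).toReal * (eLpNorm g (6 / 5) volume).toReal := by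
  have hd : MemLp (fun x => C * decay x) 6 volume := memLp_decay.const_mul C
  have hu6 : MemLp u 6 volume := hd.mono' hu (ae_of_all _ hC)
  have hle := eLpNorm_le_eLpNorm_mul_eLpNorm_of_nnnorm (p := 6 / 5) (q := 6) (r := 1) hg.1 hu
    (fun a b => (inner ℝ a b : ℝ)) 1 (ae_of_all _ fun x => by
      simpa using nnnorm_inner_le_nnnorm (𝕜 := ℝ) (g x) (u x))
  simp only [ENNReal.coe_one, one_mul] at hle
  have hfin : eLpNorm g (6 / 5) volume * eLpNorm u 6 volume < ⊤ :=
    ENNReal.mul_lt_top hg.2 hu6.2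
  have hint : Integrable (fun x => (inner ℝ (g x) (u x) : ℝ)) :=
    memLp_one_iff_integrable.1 ⟨hg.1.inner hu, hle.trans_lt hfin⟩
  refine ⟨hint, ?_⟩
  refine abs_integral_le_integral_abs.trans ?_
  have h1 : ∫ x, |(inner ℝ (g x) (u x) : ℝ)| =
      (eLpNorm (fun x => (inner ℝ (g x) (u x) : ℝ)) 1 volume).toReal := by
    rw [eLpNorm_one_eq_lintegral_enorm, ← integral_norm_eq_lintegral_enorm hint.1]
    rfl
  rw [h1, mul_comm, ← ENNReal.toReal_mul]
  refine ENNReal.toReal_mono (ENNReal.mul_lt_top hg.2 hd.2).ne (hle.trans ?_)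
  gcongr
  exact eLpNorm_mono_real hC

/-! ### Radii and sums over disjoint balls -/

section Radii

variable {lam : ℝ} {r : ℕ → ℝ}

lemma radius_pos (hlam : 0 < lam) (hr : ∀ n : ℕ, 0 < n → lam = 4 * Real.pi / 3 * n * r n ^ 3)
    {n : ℕ} (hn : 0 < n) : 0 < r n := by
  have hn' : (0 : ℝ) < n := by exact_mod_cast hn
  have h1 : 0 < 4 * Real.pi / 3 * n := by positivity
  have h2 : 0 < r n ^ 3 := by
    have := hr n hn
    rw [this] at hlam
    exact pos_of_mul_pos_right hlam h1.le
  exact (Odd.pow_pos_iff (by decide)).1 h2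

lemma tendsto_radius (hlam : 0 < lam)
    (hr : ∀ n : ℕ, 0 < n → lam = 4 * Real.pi / 3 * n * r n ^ 3) : Tendsto r atTop (𝓝 0) := by
  have h1 : Tendsto (fun n : ℕ => (lam * 3 / (4 * Real.pi) / n : ℝ) ^ (1 / 3 : ℝ)) atTop
      (𝓝 (0 ^ (1 / 3 : ℝ))) :=
    (tendsto_const_div_atTop_nhds_zero_nat _).rpow_const (by norm_num)
  rw [Real.zero_rpow (by norm_num)] at h1
  refine h1.congr' ?_
  filter_upwards [eventually_gt_atTop 0] with n hn
  have hn' : (0 : ℝ) < n := by exact_mod_cast hn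
  have h2 : lam * 3 / (4 * Real.pi) / n = r n ^ 3 := by
    rw [hr n hn]; field_simp
  rw [h2, ← Real.rpow_natCast, ← Real.rpow_mul (radius_pos hlam hr hn).le]
  norm_num

lemma exists_radius_bound (hlam : 0 < lam)
    (hr : ∀ n : ℕ, 0 < n → lam = 4 * Real.pi / 3 * n * r n ^ 3) :
    ∃ r₁, 0 ≤ r₁ ∧ ∀ n, r n ≤ r₁ := by
  obtain ⟨b, hb⟩ := (tendsto_radius hlam hr).bddAbove_range
  exact ⟨max b 0, le_max_right _ _, fun n => (hb ⟨n, rfl⟩).trans (le_max_left _ _)⟩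

variable {X : (n : ℕ) → Fin n → E3}

lemma Separated.two_mul_le (hlam : 0 < lam)
    (hr : ∀ n : ℕ, 0 < n → lam = 4 * Real.pi / 3 * n * r n ^ 3) (hX : Separated X r)
    {n : ℕ} (i j : Fin n) (hij : i ≠ j) : 2 * r n ≤ ‖X n i - X n j‖ := by
  obtain ⟨M, hM, h⟩ := hX
  have hrn := radius_pos hlam hr (Fin.pos i)
  refine le_trans ?_ (h n i j hij)
  gcongr

/-- Since the balls are disjoint with total volume `lam`, the empirical sums of a nonnegative
continuous function are asymptotically bounded by its integral. -/
lemma eventually_sum_le_integral (hlam : 0 < lam)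
    (hr : ∀ n : ℕ, 0 < n → lam = 4 * Real.pi / 3 * n * r n ^ 3) (hX : Separated X r)
    {h : E3 → ℝ} (hc : Continuous h) (hsupp : HasCompactSupport h) (h0 : ∀ x, 0 ≤ h x)
    {ε : ℝ} (hε : 0 < ε) :
    ∀ᶠ n : ℕ in atTop, lam / n * ∑ i, h (X n i) ≤ (∫ x, h x) + ε := by
  -- An oscillation ε / lam on each of n balls of volume lam / n adds up to exactly ε.
  obtain ⟨δ, hδ, hu⟩ := Metric.uniformContinuous_iff.1
    (hsupp.uniformContinuous_of_continuous hc) (ε / lam) (by positivity)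
  have hint : Integrable h := hc.integrable_of_hasCompactSupport hsupp
  filter_upwards [(tendsto_radius hlam hr).eventually (gt_mem_nhds hδ), eventually_gt_atTop 0]
    with n hrδ hn
  have hn' : (0 : ℝ) < n := by exact_mod_cast hn
  have hrn := radius_pos hlam hr hn
  have hvol : lam / n = 4 * Real.pi / 3 * r n ^ 3 := by
    have := hr n hn
    field_simp
    linarith
  have h1 : ∀ i, lam / n * h (X n i) ≤
      (∫ x in Metric.ball (X n i) (r n), h x) + lam / n * (ε / lam) := fun i => by
    have h2 : ∫ _x in Metric.ball (X n i) (r n), h (X n i) ≤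
        ∫ x in Metric.ball (X n i) (r n), (h x + ε / lam) := by
      refine setIntegral_mono_on (integrableOn_const measure_ball_lt_top.ne)
        (hint.integrableOn.add (integrableOn_const measure_ball_lt_top.ne))
        measurableSet_ball fun x hx => ?_
      have h3 := hu (lt_trans (Metric.mem_ball.1 hx) hrδ)
      rw [Real.dist_eq] at h3
      linarith [neg_abs_le (h x - h (X n i))]
    rwa [setIntegral_const, integral_add hint.integrableOn
      (integrableOn_const measure_ball_lt_top.ne), setIntegral_const,
      volume_real_ball _ hrn.le, ← hvol, smul_eq_mul, smul_eq_mul] at h2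
  calc lam / n * ∑ i, h (X n i) = ∑ i, lam / n * h (X n i) := Finset.mul_sum _ _ _
    _ ≤ ∑ i, ((∫ x in Metric.ball (X n i) (r n), h x) + lam / n * (ε / lam)) :=
        Finset.sum_le_sum fun i _ => h1 i
    _ = (∫ x in ⋃ i ∈ Finset.univ, Metric.ball (X n i) (r n), h x) + ε := by
        rw [Finset.sum_add_distrib, integral_biUnion_finset Finset.univ
          (fun _ _ => measurableSet_ball) (fun i _ j _ hij => ?_) fun _ _ => hint.integrableOn]
        · simp only [Finset.sum_const, Finset.card_univ, Fintype.card_fin, nsmul_eq_mul]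
          field_simp
        · refine Metric.ball_disjoint_ball ?_
          rw [dist_eq_norm]
          linarith [hX.two_mul_le hlam hr i j hij]
    _ ≤ _ := by
        have := setIntegral_le_integral (s := ⋃ i ∈ Finset.univ, Metric.ball (X n i) (r n)) hint
          (ae_of_all _ h0)
        linarith

end Radii

/-! ### The bad indices -/

/-- A continuous function is bounded everywhere by its essential supremum. -/
lemma norm_le_toReal_eLpNorm_top {V : Type*} [NormedAddCommGroup V] {h : E3 → V}
    (hc : Continuous h) (hh : MemLp h ∞ volume) (x : E3) :
    ‖h x‖ ≤ (eLpNorm h ∞ volume).toReal := by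
  have hd := Measure.dense_of_ae (ae_norm_le_toReal hh)
  have hcl : IsClosed {x | ‖h x‖ ≤ (eLpNorm h ∞ volume).toReal} :=
    isClosed_le hc.norm continuous_const
  have := hcl.closure_eq ▸ hd x
  exact this

/-- The indices that are not good. -/
def badSet {n : ℕ} (X : Fin n → E3) (η : ℝ) : Finset (Fin n) := Finset.univ \ goodSet X η

lemma FewClose.card_badSet_le {X : (n : ℕ) → Fin n → E3} {K : ℝ} (hX : FewClose X K) {η : ℝ}
    (hη : 0 < η) (n : ℕ) : ((badSet (X n) η).card : ℝ) ≤ K * η ^ 3 * n := by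
  refine le_trans ?_ (hX η hη n)
  rw [← Set.ncard_coe_finset]
  refine Nat.cast_le.2 (Set.ncard_le_ncard ?_ (Set.toFinite _))
  intro i hi
  simp only [badSet, goodSet, Finset.coe_sdiff, Finset.coe_univ, Finset.coe_filter,
    Finset.mem_univ, true_and, Set.mem_sdiff, Set.mem_univ, Set.mem_ofPred_eq, not_forall,
    not_le] at hi
  obtain ⟨j, hj, h⟩ := hi
  exact ⟨j, hj, h.le⟩

lemma conjExponent_ofReal {p : ℝ} (hp : 1 < p) :
    ENNReal.conjExponent (ENNReal.ofReal p) = ENNReal.ofReal (1 + (p - 1)⁻¹) := by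
  have h1 : 0 < p - 1 := by linarith
  rw [ENNReal.conjExponent, ENNReal.ofReal_add zero_le_one (by positivity), ENNReal.ofReal_one,
    ENNReal.ofReal_inv_of_pos h1, ENNReal.ofReal_sub _ zero_le_one, ENNReal.ofReal_one]

/-- Discrete Hölder with weights lam / n: the constant factor sees only the number of bad indices,
while the other factor is enlarged to all indices and compared with an integral over the disjoint
balls. -/
lemma eventually_sum_badSet_le {p : ℝ} (hp : 1 ≤ p) {K lam η : ℝ} {r : ℕ → ℝ}
    {X : (n : ℕ) → Fin n → E3} (hlam : 0 < lam)
    (hr : ∀ n : ℕ, 0 < n → lam = 4 * Real.pi / 3 * n * r n ^ 3) (hX : Separated X r)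
    (hXK : FewClose X K) (hη : 0 < η) {V : Type*} [NormedAddCommGroup V] {h : E3 → V}
    (hc : Continuous h) (hsupp : HasCompactSupport h) {ε : ℝ} (hε : 0 < ε) :
    ∀ᶠ n : ℕ in atTop, lam / n * ∑ i ∈ badSet (X n) η, ‖h (X n i)‖ ≤
      (lam * (K * η ^ 3)) ^ (1 / p) *
        ((eLpNorm h (ENNReal.conjExponent (ENNReal.ofReal p)) volume).toReal + ε) := by
  have hcard : ∀ n : ℕ, 0 < n →
      lam / n * ((badSet (X n) η).card : ℝ) ≤ lam * (K * η ^ 3) := fun n hn => by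
    have hn' : (0 : ℝ) < n := by exact_mod_cast hn
    calc _ ≤ lam / n * (K * η ^ 3 * n) := by gcongr; exact hXK.card_badSet_le hη n
      _ = _ := by field_simp
  -- No sign of K is assumed; the cardinality bound at n = 1 forces nonnegativity.
  have hKη : 0 ≤ lam * (K * η ^ 3) := le_trans (by positivity) (hcard 1 one_pos)
  -- For p = 1 the conjugate exponent is ∞, and the supremum replaces the comparison of sums with
  -- integrals.
  rcases eq_or_lt_of_le hp with rfl | hp
  · filter_upwards [eventually_gt_atTop 0] with n hn
    have hq : ENNReal.conjExponent (ENNReal.ofReal 1) = ⊤ := by simp [ENNReal.conjExponent]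
    rw [hq, div_one, Real.rpow_one]
    have hmem : MemLp h ∞ volume := hc.memLp_of_hasCompactSupport hsupp
    set N := (eLpNorm h ∞ volume).toReal
    have hN : 0 ≤ N := ENNReal.toReal_nonneg
    calc lam / n * ∑ i ∈ badSet (X n) η, ‖h (X n i)‖
        ≤ lam / n * ∑ _i ∈ badSet (X n) η, N := by
          gcongr; exact norm_le_toReal_eLpNorm_top hc hmem _
      _ = lam / n * ((badSet (X n) η).card : ℝ) * N := by
          rw [Finset.sum_const, nsmul_eq_mul]; ring
      _ ≤ lam * (K * η ^ 3) * (N + ε) := by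
          have hNε : N ≤ N + ε := by linarith
          exact mul_le_mul (hcard n hn) hNε hN hKη
  set q := 1 + (p - 1)⁻¹
  have hp1 : 0 < p - 1 := by linarith
  have hq0 : 0 < q := by positivity
  have hpq : p.HolderConjugate q := by
    rw [Real.holderConjugate_iff]
    refine ⟨hp, ?_⟩
    simp only [q]
    field_simp
    ring
  have hmem : MemLp h (ENNReal.ofReal q) volume := hc.memLp_of_hasCompactSupport hsupp
  set I := ∫ x, ‖h x‖ ^ q
  have hI : 0 ≤ I := integral_nonneg fun _ => by positivity
  have hN : (eLpNorm h (ENNReal.conjExponent (ENNReal.ofReal p)) volume).toReal = I ^ (1 / q) := by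
    rw [conjExponent_ofReal hp, hmem.eLpNorm_eq_integral_rpow_norm (by simpa using hq0)
      ENNReal.ofReal_ne_top, ENNReal.toReal_ofReal hq0.le, ENNReal.toReal_ofReal (by positivity),
      one_div]
  -- The error δ allowed in the integral of the q-th power is chosen so that its effect after the
  -- q-th root is at most ε.
  obtain ⟨δ, hδ, hδε⟩ : ∃ δ, 0 < δ ∧ (I + δ) ^ (1 / q) ≤ I ^ (1 / q) + ε := by
    have hcont : Tendsto (fun δ : ℝ => (I + δ) ^ (1 / q)) (𝓝[>] 0) (𝓝 (I ^ (1 / q))) := by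
      have : Tendsto (fun δ : ℝ => (I + δ) ^ (1 / q)) (𝓝 0) (𝓝 ((I + 0) ^ (1 / q))) :=
        ((continuous_const.add continuous_id).tendsto 0).rpow_const
          (Or.inr (by positivity))
      rw [add_zero] at this
      exact this.mono_left nhdsWithin_le_nhds
    obtain ⟨δ, h1, h2⟩ := ((hcont.eventually (ge_mem_nhds (lt_add_of_pos_right _ hε))).and
      self_mem_nhdsWithin).exists
    exact ⟨δ, h2, h1⟩
  have hcq : Continuous fun x => ‖h x‖ ^ q := hc.norm.rpow_const fun _ => Or.inr hq0.le
  have hsq : HasCompactSupport fun x => ‖h x‖ ^ q :=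
    hsupp.comp_left (g := fun v => ‖v‖ ^ q) (by simp [Real.zero_rpow hq0.ne'])
  filter_upwards [eventually_sum_le_integral hlam hr hX hcq hsq (fun _ => by positivity) hδ,
    eventually_gt_atTop 0] with n hsum hn
  have hn' : (0 : ℝ) < n := by exact_mod_cast hn
  have hw : 0 < lam / n := by positivity
  -- The weight is split as (lam / n)^(1/p) · (lam / n)^(1/q).
  have hH := Real.inner_le_Lp_mul_Lq (badSet (X n) η) (fun _ => (lam / n) ^ (1 / p))
    (fun i => (lam / n) ^ (1 / q) * ‖h (X n i)‖) hpq
  have e1 : ∀ t : ℝ, (lam / n) ^ (1 / p) * ((lam / n) ^ (1 / q) * t) = lam / n * t := fun t => by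
    rw [← mul_assoc, ← Real.rpow_add hw]
    have : 1 / p + 1 / q = 1 := by simpa using hpq.inv_add_inv_eq_one
    rw [this, Real.rpow_one]
  have e2 : |(lam / n) ^ (1 / p)| ^ p = lam / n := by
    rw [abs_of_nonneg (by positivity), ← Real.rpow_mul hw.le, one_div_mul_cancel (by linarith),
      Real.rpow_one]
  have e3 : ∀ i, |(lam / n) ^ (1 / q) * ‖h (X n i)‖| ^ q = lam / n * ‖h (X n i)‖ ^ q := fun i => by
    rw [abs_of_nonneg (by positivity), Real.mul_rpow (by positivity) (norm_nonneg _),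
      ← Real.rpow_mul hw.le, one_div_mul_cancel hq0.ne', Real.rpow_one]
  simp only [e1, e2, e3] at hH
  rw [Finset.mul_sum, hN]
  refine hH.trans ?_
  gcongr
  · rw [Finset.sum_const, nsmul_eq_mul, mul_comm]
    exact hcard n hn
  · refine le_trans ?_ hδε
    gcongr
    refine le_trans ?_ hsum
    rw [Finset.mul_sum]
    exact Finset.sum_le_sum_of_subset_of_nonneg (Finset.subset_univ _) fun _ _ _ => by positivity

lemma measurable_sum_phiBall (φ : E3 → E3) (r : ℝ) {n : ℕ} (X : Fin n → E3)
    (G : Finset (Fin n)) : Measurable fun x => ∑ i ∈ G, phiBall φ r (X i) x :=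
  Finset.measurable_sum _ fun i _ => measurable_phiBall φ r (X i)

/-! ### The full approximation: uniform domination and cancellation -/

section Setup

variable {φ : E3 → E3} {ρ : E3 → ℝ} {s R lam : ℝ} {r : ℕ → ℝ} {X : (n : ℕ) → Fin n → E3}

lemma aestronglyMeasurable_phiApp (hφ : ContDiff ℝ ∞ φ) (hdiv : ∀ x, divergence φ x = 0)
    (hs : ∀ y, ‖fderiv ℝ φ y‖ ≤ s) (hR : ∀ y, R ≤ ‖y‖ → fderiv ℝ φ y = 0)
    (hρ : MemLp ρ ∞ volume) (lam η r : ℝ) {n : ℕ} (X : Fin n → E3) :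
    AEStronglyMeasurable (phiApp lam ρ φ η r X) volume :=
  (aestronglyMeasurable_phiFree hφ hdiv hs hR hρ lam).add
    (measurable_sum_phiBall φ r X _).aestronglyMeasurable

/-- The approximations are dominated by a multiple of `decay`, uniformly in `n`. -/
lemma exists_norm_phiApp_le (hφ : ContDiff ℝ ∞ φ) (hdiv : ∀ x, divergence φ x = 0)
    (hs : ∀ y, ‖fderiv ℝ φ y‖ ≤ s) (hR1 : 1 ≤ R) (hR : ∀ y, R ≤ ‖y‖ → fderiv ℝ φ y = 0)
    (hρ : MemLp ρ ∞ volume) (hlam : 0 < lam)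
    (hr : ∀ n : ℕ, 0 < n → lam = 4 * Real.pi / 3 * n * r n ^ 3) (hX : Separated X r) (η : ℝ) :
    ∃ C, ∀ n x, ‖phiApp lam ρ φ η (r n) (X n) x‖ ≤ C * decay x := by
  have hs0 : 0 ≤ s := (norm_nonneg _).trans (hs 0)
  obtain ⟨r₁, hr₁, hrle⟩ := exists_radius_bound hlam hr
  obtain ⟨C₁, hC₁, h₁⟩ := exists_ballPotential_le hR1
  obtain ⟨C₂, hC₂, h₂⟩ := exists_ballPotential_le (R := R + r₁) (by linarith)
  set A := |15 * lam / (8 * Real.pi)| * ((eLpNorm ρ ∞ volume).toReal * (9 * s))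
  have hA : 0 ≤ A := by positivity
  refine ⟨A * C₁ + 54 * s * C₂, fun n x => ?_⟩
  have hfree : ‖phiFree lam ρ φ x‖ ≤ A * (C₁ * decay x) :=
    (norm_phiFree_le hφ hdiv hs hR hρ lam x).trans (mul_le_mul_of_nonneg_left (h₁ x) hA)
  have hsum : ‖∑ i ∈ goodSet (X n) η, phiBall φ (r n) (X n i) x‖ ≤ 54 * s * (C₂ * decay x) := by
    -- For n = 0 the radius is unconstrained, but the sum is empty.
    rcases Nat.eq_zero_or_pos n with rfl | hn
    · rw [Finset.eq_empty_of_isEmpty (goodSet (X 0) η), Finset.sum_empty, norm_zero]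
      have := decay_nonneg x
      positivity
    · refine (norm_sum_phiBall_le hs hR (radius_pos hlam hr hn) (hrle n)
        (hX.two_mul_le hlam hr) _ x).trans ?_
      gcongr
      exact h₂ x
  refine (norm_add_le _ _).trans ((add_le_add hfree hsum).trans_eq ?_)
  ring

/-- Against a fixed bounded integrable field, the approximation acts like the empirical fluctuation
of the stresslet pairing, up to the bad indices and an error of order `r`. -/
lemma abs_integral_inner_phiApp_le (hφ : ContDiff ℝ ∞ φ) (hdiv : ∀ x, divergence φ x = 0)
    (hs : ∀ y, ‖fderiv ℝ φ y‖ ≤ s) (hR : ∀ y, R ≤ ‖y‖ → fderiv ℝ φ y = 0)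
    (hρ : MemLp ρ ∞ volume) (hlam : 0 < lam)
    (hr : ∀ n : ℕ, 0 < n → lam = 4 * Real.pi / 3 * n * r n ^ 3)
    {f : E3 → E3} (hf1 : MemLp f 1 volume) (hf : MemLp f ∞ volume)
    (hfree : Integrable fun x => inner ℝ (f x) (phiFree lam ρ φ x))
    {n : ℕ} (hn : 0 < n) (η : ℝ) :
    |∫ x, inner ℝ (f x) (phiApp lam ρ φ η (r n) (X n) x)| ≤
      15 * lam / (8 * Real.pi) * |1 / (n : ℝ) * ∑ i, stressletPairing f (symGrad φ) (X n i) -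
        ∫ y, stressletPairing f (symGrad φ) y * ρ y| +
      (eLpNorm f ∞ volume).toReal * 36 * (∫ x : E3, coreWeight ‖x‖) * s *
        (lam * 3 / (4 * Real.pi)) * r n +
      135 * rieszBound f / (8 * Real.pi) *
        (lam / n * ∑ i ∈ badSet (X n) η, ‖fderiv ℝ φ (X n i)‖) := by
  have hs0 : 0 ≤ s := (norm_nonneg _).trans (hs 0)
  have hn' : (0 : ℝ) < n := by exact_mod_cast hn
  have hrn := radius_pos hlam hr hn
  have hpi := Real.pi_pos
  have hr3 : r n ^ 3 = lam * 3 / (4 * Real.pi) / n := by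
    rw [hr n hn]; field_simp
  set g := stressletPairing f (symGrad φ)
  set c := 15 * lam / (8 * Real.pi) with hc
  have hc0 : 0 < c := by positivity
  set E := (eLpNorm f ∞ volume).toReal * 36 * (∫ x : E3, coreWeight ‖x‖)
  have hE : 0 ≤ E := mul_nonneg (by positivity) (integral_nonneg fun _ => coreWeight_nonneg _)
  -- The matching of strengths behind the cancellation: (5/2) · 3/(4π) = 15/(8π).
  have hcn : 5 / 2 * r n ^ 3 = c / n := by rw [hr3, hc]; field_simp; norm_num
  have hball := fun i => integrable_inner_phiBall_and_abs_sub_le hf1 hf φ hrn (X n i)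
  have hsplit : ∫ x, inner ℝ (f x) (phiApp lam ρ φ η (r n) (X n) x) =
      -c * (∫ y, g y * ρ y) +
        ∑ i ∈ goodSet (X n) η, ∫ x, inner ℝ (f x) (phiBall φ (r n) (X n i) x) := by
    rw [← integral_inner_phiFree hφ hdiv hs hR hρ lam hf1 hf,
      ← integral_finsetSum _ fun i _ => (hball i).1,
      ← integral_add hfree (integrable_finsetSum _ fun i _ => (hball i).1)]
    refine integral_congr_ae (ae_of_all _ fun x => ?_)
    simp only [phiApp, inner_add_right, inner_sum]
  have herr : |∑ i ∈ goodSet (X n) η, ((∫ x, inner ℝ (f x) (phiBall φ (r n) (X n i) x)) -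
      c / n * g (X n i))| ≤ E * s * (lam * 3 / (4 * Real.pi)) * r n := by
    calc _ ≤ ∑ i ∈ goodSet (X n) η, E * s * r n ^ 4 := by
          refine (Finset.abs_sum_le_sum_abs _ _).trans (Finset.sum_le_sum fun i _ => ?_)
          rw [← hcn]
          refine (hball i).2.trans ?_
          gcongr
          exact hs _
      _ ≤ ∑ _i : Fin n, E * s * r n ^ 4 :=
          Finset.sum_le_sum_of_subset_of_nonneg (Finset.subset_univ _) fun _ _ _ => by positivity
      -- As n r³ is constant, n errors of order r⁴ sum to order r.
      _ = E * s * (n * r n ^ 3) * r n := by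
          rw [Finset.sum_const, Finset.card_univ, Fintype.card_fin, nsmul_eq_mul]; ring
      _ = _ := by rw [hr3]; field_simp
  have hbad : |c / n * ∑ i ∈ badSet (X n) η, g (X n i)| ≤ 135 * rieszBound f / (8 * Real.pi) *
        (lam / n * ∑ i ∈ badSet (X n) η, ‖fderiv ℝ φ (X n i)‖) := by
    rw [abs_mul, abs_of_pos (by positivity : 0 < c / n)]
    calc _ ≤ c / n * ∑ i ∈ badSet (X n) η, 9 * rieszBound f * ‖fderiv ℝ φ (X n i)‖ := by
          gcongr
          exact (Finset.abs_sum_le_sum_abs _ _).trans (Finset.sum_le_sum fun i _ =>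
            abs_stressletPairing_le hf1 hf (abs_symGrad_le φ _))
      _ = _ := by rw [← Finset.mul_sum, hc]; ring
  have hgb : ∑ i ∈ badSet (X n) η, g (X n i) + ∑ i ∈ goodSet (X n) η, g (X n i) =
      ∑ i, g (X n i) := Finset.sum_sdiff (Finset.subset_univ _)
  -- The good sum is written as the full sum minus the bad one, since weak convergence only sees the
  -- full empirical measure.
  have key : ∫ x, inner ℝ (f x) (phiApp lam ρ φ η (r n) (X n) x) =
      c * (1 / (n : ℝ) * ∑ i, g (X n i) - ∫ y, g y * ρ y) +
      ∑ i ∈ goodSet (X n) η, ((∫ x, inner ℝ (f x) (phiBall φ (r n) (X n i) x)) -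
        c / n * g (X n i)) - c / n * ∑ i ∈ badSet (X n) η, g (X n i) := by
    rw [hsplit, Finset.sum_sub_distrib, ← Finset.mul_sum, ← hgb]
    ring
  rw [key]
  refine (abs_sub _ _).trans (add_le_add ((abs_add_le _ _).trans (add_le_add ?_ herr)) hbad)
  rw [abs_mul, abs_of_pos hc0]

end Setup

/-! ### Passage to the limit -/

lemma limsup_ofReal_le_of_eventually {u : ℕ → ℝ} {A N : ℝ}
    (h : ∀ ε, 0 < ε → ∀ᶠ n in atTop, u n ≤ ε + A * (N + ε)) :
    limsup (fun n => ENNReal.ofReal (u n)) atTop ≤ ENNReal.ofReal (A * N) := by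
  have hcont : Tendsto (fun ε : ℝ => ENNReal.ofReal (ε + A * (N + ε))) (𝓝[>] 0)
      (𝓝 (ENNReal.ofReal (A * N))) := by
    have : Tendsto (fun ε : ℝ => ENNReal.ofReal (ε + A * (N + ε))) (𝓝 0)
        (𝓝 (ENNReal.ofReal (0 + A * (N + 0)))) :=
      (ENNReal.continuous_ofReal.comp (by fun_prop : Continuous fun ε : ℝ =>
        ε + A * (N + ε))).tendsto 0
    simp only [zero_add, add_zero] at this
    exact this.mono_left nhdsWithin_le_nhds
  refine ge_of_tendsto hcont ?_
  filter_upwards [self_mem_nhdsWithin] with ε hε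
  refine limsup_le_of_le (by isBoundedDefault) ?_
  filter_upwards [h ε hε] with n hn using ENNReal.ofReal_le_ofReal hn

theorem proposition3
    (p : ℝ) (hp : 1 ≤ p)
    (f : E3 → E3) (hf_one : MemLp f 1 volume) (hf_top : MemLp f ∞ volume)
    (K : ℝ) (hK : 0 < K) :
    ∃ C : ℝ, 0 < C ∧
      ∀ (lam : ℝ) (r : ℕ → ℝ) (X : (n : ℕ) → Fin n → E3)
        (ρ : E3 → ℝ) (O : Set E3) (F : ℕ → E3 → E3) (φ : E3 → E3) (η : ℝ),
        0 < lam →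
        (∀ n : ℕ, 0 < n → lam = 4 * Real.pi / 3 * n * r n ^ 3) →
        MemLp ρ ∞ volume →
        IsOpen O → Bornology.IsBounded O → (∀ᵐ x, x ∉ O → ρ x = 0) →
        EmpiricalLimit X ρ →
        Separated X r →
        FewClose X K →
        (∀ n, MemLp (F n) (6 / 5) volume) →
        Tendsto (fun n => eLpNorm (F n - f) (6 / 5) volume) atTop (𝓝 0) →
        ContDiff ℝ ∞ φ → HasCompactSupport φ → (∀ x, divergence φ x = 0) →
        0 < η →
        (∀ n, Integrable (fun x => inner ℝ (F n x) (phiApp lam ρ φ η (r n) (X n) x)) volume) ∧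
        limsup (fun n : ℕ => ENNReal.ofReal
            |∫ x, inner ℝ (F n x) (phiApp lam ρ φ η (r n) (X n) x)|) atTop
          ≤ ENNReal.ofReal (C * (lam * η ^ 3) ^ (1 / p))
            * eLpNorm (fderiv ℝ φ) (ENNReal.conjExponent (ENNReal.ofReal p)) volume := by
  have hB := rieszBound_nonneg f
  set B := 135 * rieszBound f / (8 * Real.pi) with hBdef
  have hB0 : 0 ≤ B := by positivity
  -- The summand 1 only secures positivity, as `rieszBound f` may vanish.
  refine ⟨B * K ^ (1 / p) + 1, by positivity, ?_⟩
  intro lam r X ρ O F φ η hlam hr hρ _ _ _ hemp hX hXK hF hFf hφ hφc hdiv hη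
  have hdc : Continuous (fderiv ℝ φ) := hφ.continuous_fderiv (by simp)
  have hds : HasCompactSupport (fderiv ℝ φ) := hφc.fderiv ℝ
  obtain ⟨s, hs⟩ := hdc.bounded_above_of_compact_support hds
  obtain ⟨R, hR1, hR⟩ : ∃ R : ℝ, 1 ≤ R ∧ ∀ y, R ≤ ‖y‖ → fderiv ℝ φ y = 0 := by
    obtain ⟨R, hR⟩ := hds.isBounded.subset_ball 0
    refine ⟨max R 1, le_max_right _ _, fun y hy => image_eq_zero_of_notMem_tsupport fun h => ?_⟩
    have := mem_ball_zero_iff.1 (hR h)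
    linarith [le_max_left R 1]
  obtain ⟨C, hC⟩ := exists_norm_phiApp_le hφ hdiv hs hR1 hR hρ hlam hr hX η
  have happ := fun n => aestronglyMeasurable_phiApp hφ hdiv hs hR hρ lam η (r n) (X n)
  refine ⟨fun n => (integrable_inner_and_abs_le_of_decay (hF n) (happ n) (hC n)).1, ?_⟩
  set N := eLpNorm (fderiv ℝ φ) (ENNReal.conjExponent (ENNReal.ofReal p)) volume
  have hNfin : N ≠ ⊤ := (hdc.memLp_of_hasCompactSupport hds).eLpNorm_ne_top
  obtain ⟨C₁, hC₁, hpot⟩ := exists_ballPotential_le hR1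
  have hdiff : ∀ᶠ n in atTop, MemLp (F n - f) (6 / 5) volume := by
    filter_upwards [hFf.eventually (gt_mem_nhds one_pos)] with n hn
    exact ⟨(hF n).1.sub hf_one.1, hn.trans ENNReal.one_lt_top⟩
  obtain ⟨n₀, hn₀⟩ := hdiff.exists
  -- f = F n₀ - (F n₀ - f), with n₀ taken where the difference has finite norm.
  have hf65 : MemLp f (6 / 5) volume := by
    simpa using (hF n₀).sub hn₀
  have hfree : Integrable fun x => inner ℝ (f x) (phiFree lam ρ φ x) := by
    refine (integrable_inner_and_abs_le_of_decay (C := |15 * lam / (8 * Real.pi)| *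
      ((eLpNorm ρ ∞ volume).toReal * (9 * s)) * C₁) hf65
      (aestronglyMeasurable_phiFree hφ hdiv hs hR hρ lam) fun x => ?_).1
    have hs0 : 0 ≤ s := (norm_nonneg _).trans (hs 0)
    rw [mul_assoc]
    exact (norm_phiFree_le hφ hdiv hs hR hρ lam x).trans
      (mul_le_mul_of_nonneg_left (hpot x) (by positivity))
  have hgc : Continuous (stressletPairing f (symGrad φ)) :=
    continuous_stressletPairing hf_one hf_top (continuous_symGrad hφ) fun y i j =>
      (abs_symGrad_le φ y i j).trans (hs y)
  let g : BoundedContinuousFunction E3 ℝ := BoundedContinuousFunction.ofNormedAddCommGroup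
    (stressletPairing f (symGrad φ)) hgc (9 * rieszBound f * s) fun y =>
      abs_stressletPairing_le hf_one hf_top fun i j => (abs_symGrad_le φ y i j).trans (hs y)
  have hg : Tendsto (fun n : ℕ => 15 * lam / (8 * Real.pi) *
      |1 / (n : ℝ) * ∑ i, stressletPairing f (symGrad φ) (X n i) -
        ∫ y, stressletPairing f (symGrad φ) y * ρ y|) atTop (𝓝 0) := by
    have h1 := ((hemp g).sub_const (∫ x, g x * ρ x)).abs.const_mul (15 * lam / (8 * Real.pi))
    rw [sub_self, abs_zero, mul_zero] at h1
    exact h1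
  have hcore : Tendsto (fun n : ℕ => (eLpNorm f ∞ volume).toReal * 36 *
      (∫ x : E3, coreWeight ‖x‖) * s * (lam * 3 / (4 * Real.pi)) * r n) atTop (𝓝 0) := by
    simpa only [mul_zero] using (tendsto_radius hlam hr).const_mul _
  -- The cost of replacing F n by f; C does not depend on n.
  have hfar : Tendsto (fun n : ℕ => (eLpNorm (fun x => C * decay x) 6 volume).toReal *
      (eLpNorm (F n - f) (6 / 5) volume).toReal) atTop (𝓝 0) := by
    have := ((ENNReal.tendsto_toReal ENNReal.zero_ne_top).comp hFf).const_mul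
      (eLpNorm (fun x => C * decay x) 6 volume).toReal
    rw [ENNReal.toReal_zero, mul_zero] at this
    exact this
  have hsmall := (hfar.add hg).add hcore
  simp only [add_zero] at hsmall
  refine (limsup_ofReal_le_of_eventually (A := B * (lam * (K * η ^ 3)) ^ (1 / p))
    (N := N.toReal) fun ε hε => ?_).trans ?_
  · filter_upwards [hsmall.eventually (gt_mem_nhds hε), hdiff, eventually_gt_atTop 0,
      eventually_sum_badSet_le hp hlam hr hX hXK hη hdc hds hε] with n h1 h2 hn h3
    have h4 := integrable_inner_and_abs_le_of_decay h2 (happ n) (hC n)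
    have h5 := (integrable_inner_and_abs_le_of_decay hf65 (happ n) (hC n)).1
    have h6 := abs_integral_inner_phiApp_le (X := X) hφ hdiv hs hR hρ hlam hr hf_one hf_top hfree
      hn η
    have h7 : ∫ x, inner ℝ (F n x) (phiApp lam ρ φ η (r n) (X n) x) =
        (∫ x, inner ℝ ((F n - f) x) (phiApp lam ρ φ η (r n) (X n) x)) +
        ∫ x, inner ℝ (f x) (phiApp lam ρ φ η (r n) (X n) x) := by
      rw [← integral_add h4.1 h5]
      refine integral_congr_ae (ae_of_all _ fun x => ?_)
      simp only [← inner_add_left, Pi.sub_apply, sub_add_cancel]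
    rw [h7]
    refine (abs_add_le _ _).trans ?_
    have h8 := mul_le_mul_of_nonneg_left h3 hB0
    rw [← mul_assoc B] at h8
    linarith [h4.2]
  · rw [← ENNReal.ofReal_toReal hNfin, ← ENNReal.ofReal_mul (by positivity)]
    refine ENNReal.ofReal_le_ofReal ?_
    have hsplit : lam * (K * η ^ 3) = K * (lam * η ^ 3) := by ring
    rw [hsplit, Real.mul_rpow hK.le (by positivity), ENNReal.toReal_ofReal ENNReal.toReal_nonneg]
    refine mul_le_mul_of_nonneg_right ?_ ENNReal.toReal_nonneg
    have : 0 ≤ (lam * η ^ 3) ^ (1 / p) := by positivity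
    linarith

end
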